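/- Let $f_1,f_2:\mathbb R^n\to\mathbb R$ be convex and continuously differentiable with locally Lipschitz continuous gradients, let $g_1,g_2:\mathbb R^n\to\mathbb R\cup\{+\infty\}$ be proper, lower semicontinuous and convex, and put $\varphi_i=f_i+g_i$ for $i=1,2$. Let $X_2=\operatorname{argmin}_{\mathbb R^n}\varphi_2$ and $X_1=\operatorname{argmin}_{X_2}\varphi_1$, the set of solutions of the bilevel problem of minimizing $\varphi_1$ over $X_2$ (minimizers are understood to have a finite value). Assume that $\inf_{x\in\operatorname{dom}g_2}\varphi_1(x)>-\infty$ and that $X_1$ is nonempty and compact. For $\sigma>0$ write $f_\sigma=\sigma f_1+f_2$ and $g_\sigma=\sigma g_1+g_2$, and for $\alpha>0$ let $T_{\sigma,\alpha}(x)=\operatorname{prox}_{\alpha g_\sigma}(x-\alpha\nabla f_\sigma(x))$, where $\operatorname{prox}_{\alpha g}(y)=\operatorname{argmin}_w\{g(w)+\frac1{2\alpha}\|w-y\|^2\}$. Let $\nu\in(0,1)$ and let $(\sigma_k)_{k\ge0}$ satisfy $\sigma_0>0$, $\sigma_{k+1}\in[\frac34\sigma_k,\sigma_k]$ for all $k$,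 $\sigma_k\to0$, $\sum_k\sigma_k=\infty$ and $\sigma_{k+1}/\sigma_k\to1$. Set $\sigma_{-1}=\sigma_0$. For differentiable $F$ and $u,v\in\mathbb R^n$ let $$\ell_F(u,v)=\frac{\langle\nabla F(u)-\nabla F(v),u-v\rangle}{\|u-v\|^2},\qquad c_F(u,v)=\frac{\|\nabla F(u)-\nabla F(v)\|^2}{\langle\nabla F(u)-\nabla F(v),u-v\rangle}\qquad(\text{with }0/0=0).$$ (1) adaBiM. Let $x^{-1}\in\mathbb R^n$, $\alpha_0\ge\alpha_{-1}>0$, $\alpha_{\max}>0$ and $\eta\in(0,1)$. Put $x^0=T_{\sigma_0,\alpha_0}(x^{-1})$ and, for $k=0,1,2,\dots$, with $\rho_k=\frac{\sigma_k\alpha_k}{\sigma_{k-1}\alpha_{k-1}}$, $\ell_k=\ell_{f_{\sigma_k}}(x^{k-1},x^k)$, $c_k=c_{f_{\sigma_k}}(x^{k-1},x^k)$ and $\ell_k^{(2)}=\ell_{f_2}(x^{k-1},x^k)$, let $$\bar\alpha_{k+1}=\min\left\{\sqrt{\tfrac{\sigma_k}{\sigma_{k-1}}(1+\rho_k)}\,\tfrac{\sigma_k}{\sigma_{k+1}}\alpha_k,\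 \frac{\sqrt{1-4\left(1-\frac{\sigma_k}{\sigma_{k-1}}\right)\alpha_k\ell_k^{(2)}}}{2\sqrt{\alpha_k\ell_k\max\{\alpha_kc_k-1,0\}}}\,\tfrac{\sigma_k}{\sigma_{k+1}}\alpha_k,\ \alpha_{\max}\right\},$$ where the second term is $+\infty$ if its denominator vanishes; let $\alpha_{k+1}$ be the largest $a\in\{\bar\alpha_{k+1}\eta^i: i\in\mathbb N\}$ such that $z=T_{\sigma_{k+1},a}(x^k)$ satisfies $a\,\ell_{f_{\sigma_{k+1}}}(x^k,z)\le\nu$, and let $x^{k+1}=T_{\sigma_{k+1},\alpha_{k+1}}(x^k)$. Then this procedure is well defined, the sequence $(x^k)$ is bounded, all its cluster points belong to $X_1$, and $\operatorname{dist}(x^k,X_1)\to0$. (2) staBiM. Suppose in addition that $\nabla f_i$ is (globally) $L_i$-Lipschitz continuous, $i=1,2$, where $L_1,L_2\ge0$ and $L_1+L_2>0$. Let $x^0\in\mathbb R^n$ and, for $k=0,1,2,\dots$, let $x^{k+1}=T_{\sigma_{k+1},\alpha_{k+1}}(x^k)$ with $\alpha_{k+1}=\frac{\nu}{\sigma_{k+1}L_1+L_2}$.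 Then this sequence is well defined and bounded, all its cluster points belong to $X_1$, and $\operatorname{dist}(x^k,X_1)\to0$. -/

import Mathlib

open Filter Topology
open scoped Gradient NNReal

noncomputable section

/-- Extended-real-valued convexity: `h` takes values in `ℝ ∪ {+∞}`, is not identically `+∞`, is
lower semicontinuous and convex. -/
structure ProperLscConvex {n : ℕ} (h : EuclideanSpace ℝ (Fin n) → EReal) : Prop where
  ne_bot : ∀ x, h x ≠ ⊥
  dom_nonempty : ∃ x, h x < ⊤
  lsc : LowerSemicontinuous h
  convex : ∀ x y, ∀ a b : ℝ, 0 < a → 0 < b → a + b = 1 →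
    h (a • x + b • y) ≤ (a : EReal) * h x + (b : EReal) * h y

/-- The set of minimizers of `h` on `S`, with the usual convention that minimizers have a finite
value (`argmin` of the constant `+∞` is empty). -/
def argminOn {n : ℕ} (h : EuclideanSpace ℝ (Fin n) → EReal)
    (S : Set (EuclideanSpace ℝ (Fin n))) : Set (EuclideanSpace ℝ (Fin n)) :=
  {x | x ∈ S ∧ h x < ⊤ ∧ IsMinOn h S x}

/-- `p = prox_{α h}(y)`, that is, `p` minimizes `h(w) + ‖w - y‖² / (2 α)` over all `w`
(used with `α > 0`). -/
def IsProx {n : ℕ} (α : ℝ) (h : EuclideanSpace ℝ (Fin n) → EReal)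
    (y p : EuclideanSpace ℝ (Fin n)) : Prop :=
  p ∈ argminOn (fun w => h w + ((‖w - y‖ ^ 2 / (2 * α) : ℝ) : EReal)) Set.univ

/-- The Lipschitz estimate `⟨∇F(u) - ∇F(v), u - v⟩ / ‖u - v‖²` (with `0 / 0 = 0`). -/
def lipEst {n : ℕ} (F : EuclideanSpace ℝ (Fin n) → ℝ) (u v : EuclideanSpace ℝ (Fin n)) : ℝ :=
  inner ℝ (∇ F u - ∇ F v) (u - v) / ‖u - v‖ ^ 2

/-- The inverse cocoercivity estimate `‖∇F(u) - ∇F(v)‖² / ⟨∇F(u) - ∇F(v), u - v⟩`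
(with `0 / 0 = 0`). -/
def cocoEst {n : ℕ} (F : EuclideanSpace ℝ (Fin n) → ℝ) (u v : EuclideanSpace ℝ (Fin n)) : ℝ :=
  ‖∇ F u - ∇ F v‖ ^ 2 / inner ℝ (∇ F u - ∇ F v) (u - v)

/-- `prev a u k` is `u (k - 1)`, where `a` plays the role of `u (-1)`. -/
def prev {β : Type*} (a : β) (u : ℕ → β) : ℕ → β
  | 0 => a
  | k + 1 => u k

/-- The data of the bilevel problem: minimize `f₁ + g₁` over the set of minimizers of `f₂ + g₂`. -/
structure BilevelProblem (n : ℕ) where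
  f₁ : EuclideanSpace ℝ (Fin n) → ℝ
  f₂ : EuclideanSpace ℝ (Fin n) → ℝ
  g₁ : EuclideanSpace ℝ (Fin n) → EReal
  g₂ : EuclideanSpace ℝ (Fin n) → EReal

namespace BilevelProblem

/-- The upper level cost. -/
def cost₁ {n : ℕ} (P : BilevelProblem n) (x : EuclideanSpace ℝ (Fin n)) : EReal :=
  (P.f₁ x : EReal) + P.g₁ x

/-- The lower level cost. -/
def cost₂ {n : ℕ} (P : BilevelProblem n) (x : EuclideanSpace ℝ (Fin n)) : EReal :=
  (P.f₂ x : EReal) + P.g₂ x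

/-- The solutions of the lower level problem. -/
def X₂ {n : ℕ} (P : BilevelProblem n) : Set (EuclideanSpace ℝ (Fin n)) :=
  argminOn P.cost₂ Set.univ

/-- The solutions of the bilevel problem. -/
def X₁ {n : ℕ} (P : BilevelProblem n) : Set (EuclideanSpace ℝ (Fin n)) :=
  argminOn P.cost₁ P.X₂

/-- The basic requirements on the problem. -/
structure BasicAssumption {n : ℕ} (P : BilevelProblem n) : Prop where
  f₁_convex : ConvexOn ℝ Set.univ P.f₁
  f₂_convex : ConvexOn ℝ Set.univ P.f₂
  f₁_contDiff : ContDiff ℝ 1 P.f₁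
  f₂_contDiff : ContDiff ℝ 1 P.f₂
  f₁_locallyLipschitz : LocallyLipschitz (∇ P.f₁)
  f₂_locallyLipschitz : LocallyLipschitz (∇ P.f₂)
  g₁_proper : ProperLscConvex P.g₁
  g₂_proper : ProperLscConvex P.g₂
  cost₁_lower : ⊥ < ⨅ x ∈ {x | P.g₂ x < ⊤}, P.cost₁ x
  X₁_nonempty : P.X₁.Nonempty
  X₁_compact : IsCompact P.X₁

/-- The smooth part `f_σ = σ f₁ + f₂` of the inversely penalized cost. -/
def f {n : ℕ} (P : BilevelProblem n) (σ : ℝ) (x : EuclideanSpace ℝ (Fin n)) : ℝ :=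
  σ * P.f₁ x + P.f₂ x

/-- The nonsmooth part `g_σ = σ g₁ + g₂` of the inversely penalized cost. -/
def g {n : ℕ} (P : BilevelProblem n) (σ : ℝ) (x : EuclideanSpace ℝ (Fin n)) : EReal :=
  (σ : EReal) * P.g₁ x + P.g₂ x

/-- `z = prox_{α g_σ}(x - α ∇f_σ(x))`: one proximal gradient step from `x` to `z`. -/
def IsProxGradStep {n : ℕ} (P : BilevelProblem n) (σ α : ℝ)
    (x z : EuclideanSpace ℝ (Fin n)) : Prop :=
  IsProx α (P.g σ) (x - α • ∇ (P.f σ) x) z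

/-- The initial trial stepsize of adaBiM, computed from
`σp = σ_{k-1}`, `σ = σ_k`, `σn = σ_{k+1}`, `αp = α_{k-1}`, `α = α_k`, `xp = x^{k-1}`, `x = x^k`.
The second term of the minimum is `+∞`, hence dropped, when its denominator vanishes. -/
def trialStepsize {n : ℕ} (P : BilevelProblem n) (αmax σp σ σn αp α : ℝ)
    (xp x : EuclideanSpace ℝ (Fin n)) : ℝ :=
  let ρ := (σ * α) / (σp * αp)
  let ℓ := lipEst (P.f σ) xp x
  let ℓ₂ := lipEst P.f₂ xp x
  let c := cocoEst (P.f σ) xp x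
  let t₁ := √(σ / σp * (1 + ρ)) * (σ / σn) * α
  let d := 2 * √(α * ℓ * max (α * c - 1) 0)
  let t₂ := √(1 - 4 * (1 - σ / σp) * (α * ℓ₂)) / d * (σ / σn) * α
  if d = 0 then min t₁ αmax else min t₁ (min t₂ αmax)

/-- `(x, α)` are the iterates `x^0, x^1, …` and stepsizes `α_0, α_1, …` of adaBiM with inverse
penalties `σ`, starting point `xinit = x^{-1}`, initial stepsizes `αinit = α_{-1}` and `α₀`, and
`σ_{-1} = σ_0`. Each `α_{k+1}` is the largest element of `{ᾱ_{k+1} ηⁱ | i ∈ ℕ}` for which the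
resulting proximal gradient step passes the linesearch test. -/
structure IsAdaBiM {n : ℕ} (P : BilevelProblem n) (η ν αmax : ℝ) (σ : ℕ → ℝ)
    (xinit : EuclideanSpace ℝ (Fin n)) (αinit α₀ : ℝ)
    (x : ℕ → EuclideanSpace ℝ (Fin n)) (α : ℕ → ℝ) : Prop where
  α_zero : α 0 = α₀
  x_zero : P.IsProxGradStep (σ 0) (α 0) xinit (x 0)
  α_succ : ∀ k : ℕ, IsGreatest
    {a : ℝ | (∃ i : ℕ, a = P.trialStepsize αmax (prev (σ 0) σ k) (σ k) (σ (k + 1))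
        (prev αinit α k) (α k) (prev xinit x k) (x k) * η ^ i) ∧
      ∃ z, P.IsProxGradStep (σ (k + 1)) a (x k) z ∧
        a * lipEst (P.f (σ (k + 1))) (x k) z ≤ ν}
    (α (k + 1))
  x_succ : ∀ k : ℕ, P.IsProxGradStep (σ (k + 1)) (α (k + 1)) (x k) (x (k + 1))

/-- `x` are the iterates of staBiM with starting point `x₀`, inverse penalties `σ` and Lipschitz
moduli `L₁`, `L₂` of the gradients of `f₁`, `f₂`. -/
structure IsStaBiM {n : ℕ} (P : BilevelProblem n) (ν L₁ L₂ : ℝ) (σ : ℕ → ℝ)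
    (x₀ : EuclideanSpace ℝ (Fin n)) (x : ℕ → EuclideanSpace ℝ (Fin n)) : Prop where
  x_zero : x 0 = x₀
  x_succ : ∀ k : ℕ,
    P.IsProxGradStep (σ (k + 1)) (ν / (σ (k + 1) * L₁ + L₂)) (x k) (x (k + 1))

/-- `x` is bounded, all its cluster points solve the bilevel problem, and its distance to the set
of solutions converges to zero. -/
structure ConvergesToSolutions {n : ℕ} (P : BilevelProblem n)
    (x : ℕ → EuclideanSpace ℝ (Fin n)) : Prop where
  bounded : Bornology.IsBounded (Set.range x)
  cluster : ∀ z, MapClusterPt z atTop x → z ∈ P.X₁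
  dist_tendsto : Tendsto (fun k => Metric.infDist (x k) P.X₁) atTop (𝓝 0)

end BilevelProblem

/-- The inverse penalties: `σ_0 > 0` and `σ_{k+1} ∈ [3/4 σ_k, σ_k]`, as both algorithms choose
them, together with `σ_k → 0`, `∑ σ_k = ∞` and `σ_{k+1} / σ_k → 1`. -/
structure IsPenaltySeq (σ : ℕ → ℝ) : Prop where
  pos : 0 < σ 0
  mem : ∀ k, σ (k + 1) ∈ Set.Icc (3 / 4 * σ k) (σ k)
  tendsto_zero : Tendsto σ atTop (𝓝 0)
  sum_eq_top : Tendsto (fun m => ∑ k ∈ Finset.range m, σ k) atTop atTop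
  ratio : Tendsto (fun k => σ (k + 1) / σ k) atTop (𝓝 1)

end

/-!
Write `φ_σ = σ φ₁ + φ₂`. Along both algorithms there is, for each solution `w`, an energy that
dominates half the squared distance to `w` and drops by at least `τ_k (φ_{σ_k}(y_k) - φ_{σ_k}(w))`
in step `k`. For staBiM it is half that squared distance itself; for adaBiM it is corrected by the
last displacement and by the penalized gap, and the two square roots in the trial stepsize are what
lets these corrections absorb the error terms of two consecutive proximal gradient steps.

With `m` a lower bound of `φ₁`, the penalized gap `σ_k (φ₁(y_k) - m) + φ₂(y_k) - min φ₂` is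
nonnegative and antitone, so the values `φ₂(y_k)` are bounded. Compactness of the solution set
bounds the joint sublevel sets of `φ₁` and `φ₂`, hence the iterates: the energies can only grow when
`φ₁(y_k)` is below the optimal value, and then `y_k` lies in such a set. On a bounded set the
gradients are Lipschitz, which keeps `τ_k` away from zero.

The limit of the gap is `0`, since otherwise each late step would lower the energy by a fixed
amount; so `φ₂(y_k) → min φ₂`. The energy also drops by at least `τ_k σ_k (φ₁(y_k) - φ₁(w))`, and
`∑ σ_k = ∞`, so infinitely often `φ₁(y_k)` is close to the optimal value or below it, which places
`y_k` near a solution whose energy is then small. From there on the energy of some solution stays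
small: either `φ₁(y_k)` is above the optimal value and the energies decrease, or it is below and
`y_k` is again near a solution.
-/

section Smooth

variable {E : Type*} [NormedAddCommGroup E] [InnerProductSpace ℝ E] [CompleteSpace E]
  {f : E → ℝ} {s : Set E} {x y u v : E}

theorem hasDerivAt_comp_add_smul_of_hasGradientAt {t : ℝ} (hf : HasGradientAt f u (x + t • v)) :
    HasDerivAt (fun r : ℝ => f (x + r • v)) (inner ℝ u v) t := by
  have hline : HasDerivAt (fun r : ℝ => x + r • v) v t := by
    simpa using ((hasDerivAt_id t).smul_const v).const_add x
  simpa [Function.comp_def] using hf.hasFDerivAt.comp_hasDerivAt t hline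

theorem add_inner_le_of_convexOn_of_hasGradientAt (hc : ConvexOn ℝ s f) (hx : x ∈ s) (hy : y ∈ s)
    (hf : HasGradientAt f u x) : f x + inner ℝ u (y - x) ≤ f y := by
  have hline : (AffineMap.lineMap x y : ℝ → E) = fun r => x + r • (y - x) := by
    ext r
    rw [AffineMap.lineMap_apply, vsub_eq_sub, vadd_eq_add, add_comm]
  have hconv : ConvexOn ℝ (AffineMap.lineMap x y ⁻¹' s) (fun r : ℝ => f (x + r • (y - x))) := by
    simpa only [Function.comp_def, hline] using hc.comp_affineMap (AffineMap.lineMap x y)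
  have hderiv : HasDerivAt (fun r : ℝ => f (x + r • (y - x))) (inner ℝ u (y - x)) 0 :=
    hasDerivAt_comp_add_smul_of_hasGradientAt (by simpa using hf)
  have hslope := hconv.le_slope_of_hasDerivAt (x := 0) (y := 1) (by simpa using hx)
    (by simpa using hy) one_pos hderiv
  simp only [slope_def_field, one_smul, zero_smul, add_zero, sub_zero, div_one,
    add_sub_cancel] at hslope
  linarith

theorem inner_sub_nonneg_of_convexOn_of_hasGradientAt (hc : ConvexOn ℝ s f) (hx : x ∈ s)
    (hy : y ∈ s) (hfx : HasGradientAt f u x) (hfy : HasGradientAt f v y) :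
    0 ≤ inner ℝ (u - v) (x - y) := by
  have hxy := add_inner_le_of_convexOn_of_hasGradientAt hc hx hy hfx
  have hyx := add_inner_le_of_convexOn_of_hasGradientAt hc hy hx hfy
  simp only [inner_sub_left, inner_sub_right] at *
  linarith

theorem eq_of_inner_sub_eq_zero_of_hasGradientAt (hc : ConvexOn ℝ Set.univ f)
    (hfx : HasGradientAt f u x) (hfy : HasGradientAt f v y) (h : inner ℝ (u - v) (x - y) = 0) :
    u = v := by
  -- both points minimize the convex function `f - ⟨v, ·⟩`
  have hmin : ∀ w, f x - inner ℝ v x ≤ f w - inner ℝ v w := by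
    intro w
    have hxy := add_inner_le_of_convexOn_of_hasGradientAt hc (Set.mem_univ x) (Set.mem_univ y) hfx
    have hyw := add_inner_le_of_convexOn_of_hasGradientAt hc (Set.mem_univ y) (Set.mem_univ w) hfy
    simp only [inner_sub_left, inner_sub_right] at *
    linarith
  have hderiv := hfx.hasFDerivAt.sub (innerSL ℝ v).hasFDerivAt
  have hzero := IsLocalMin.hasFDerivAt_eq_zero (Eventually.of_forall hmin) hderiv
  refine ext_inner_right ℝ fun w => ?_
  simpa [sub_eq_zero] using DFunLike.congr_fun hzero w

theorem le_add_inner_gradient_add_of_lipschitzWith (hf : Differentiable ℝ f) {L : ℝ≥0}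
    (hL : LipschitzWith L (∇ f)) (x y : E) :
    f y ≤ f x + inner ℝ (∇ f x) (y - x) + L / 2 * ‖y - x‖ ^ 2 := by
  set d := y - x with hd
  have hline (t : ℝ) : HasDerivAt (fun r : ℝ => f (x + r • d)) (inner ℝ (∇ f (x + t • d)) d) t :=
    hasDerivAt_comp_add_smul_of_hasGradientAt (hf _).hasGradientAt
  have hquad (t : ℝ) : HasDerivAt
      (fun r : ℝ => f x + r * inner ℝ (∇ f x) d + L / 2 * ‖d‖ ^ 2 * r ^ 2)
      (inner ℝ (∇ f x) d + L / 2 * ‖d‖ ^ 2 * (2 * t)) t := by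
    simpa using (((hasDerivAt_id' t).mul_const (inner ℝ (∇ f x) d)).const_add (f x)).fun_add
      ((hasDerivAt_pow 2 t).const_mul (L / 2 * ‖d‖ ^ 2))
  have hbound : ∀ t ∈ Set.Ico (0 : ℝ) 1,
      inner ℝ (∇ f (x + t • d)) d ≤ inner ℝ (∇ f x) d + L / 2 * ‖d‖ ^ 2 * (2 * t) := by
    intro t ht
    have hlip : ‖∇ f (x + t • d) - ∇ f x‖ ≤ L * (t * ‖d‖) := by
      simpa [norm_smul, abs_of_nonneg ht.1] using hL.norm_sub_le (x + t • d) x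
    have hinner := (real_inner_le_norm (∇ f (x + t • d) - ∇ f x) d).trans
      (mul_le_mul_of_nonneg_right hlip (norm_nonneg d))
    rw [inner_sub_left] at hinner
    linarith
  have hle := image_le_of_deriv_right_le_deriv_boundary
    (fun t _ => (hline t).continuousAt.continuousWithinAt)
    (fun t _ => (hline t).hasDerivWithinAt) (by simp)
    (fun t _ => (hquad t).continuousAt.continuousWithinAt)
    (fun t _ => (hquad t).hasDerivWithinAt) hbound (Set.right_mem_Icc.2 zero_le_one)
  simpa only [hd, one_smul, add_sub_cancel, one_mul, one_pow, mul_one] using hle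

end Smooth

theorem coe_mul_lt_top_iff_of_pos {c : ℝ} (hc : 0 < c) {a : EReal} :
    (c : EReal) * a < ⊤ ↔ a < ⊤ := by
  simp only [lt_top_iff_ne_top, EReal.mul_ne_top]
  simp [hc, hc.le]

section Prox

variable {n : ℕ} {h k : EuclideanSpace ℝ (Fin n) → EReal}

namespace ProperLscConvex

theorem coe_toReal (hh : ProperLscConvex h) {x : EuclideanSpace ℝ (Fin n)} (hx : h x < ⊤) :
    ((h x).toReal : EReal) = h x :=
  EReal.coe_toReal hx.ne (hh.ne_bot x)

theorem convexOn_toReal (hh : ProperLscConvex h) :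
    ConvexOn ℝ {x | h x < ⊤} fun x => (h x).toReal := by
  have hconv : ∀ x, h x < ⊤ → ∀ y, h y < ⊤ → ∀ a b : ℝ, 0 < a → 0 < b → a + b = 1 →
      h (a • x + b • y) ≤ ((a * (h x).toReal + b * (h y).toReal : ℝ) : EReal) := by
    intro x hx y hy a b ha hb hab
    simpa only [EReal.coe_add, EReal.coe_mul, hh.coe_toReal hx, hh.coe_toReal hy]
      using hh.convex x y a b ha hb hab
  have hdom : Convex ℝ {x | h x < ⊤} :=
    convex_iff_forall_pos.2 fun x hx y hy a b ha hb hab =>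
      (hconv x hx y hy a b ha hb hab).trans_lt (EReal.coe_lt_top _)
  refine convexOn_iff_forall_pos.2 ⟨hdom, fun x hx y hy a b ha hb hab => ?_⟩
  rw [← EReal.coe_le_coe_iff, hh.coe_toReal (hdom hx hy ha.le hb.le hab)]
  exact hconv x hx y hy a b ha hb hab

theorem of_convexOn_toReal (hbot : ∀ x, h x ≠ ⊥) (hdom : ∃ x, h x < ⊤)
    (hlsc : LowerSemicontinuous h) (hconv : ConvexOn ℝ {x | h x < ⊤} fun x => (h x).toReal) :
    ProperLscConvex h where
  ne_bot := hbot
  dom_nonempty := hdom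
  lsc := hlsc
  convex x y a b ha hb hab := by
    have hmul {c : ℝ} (hc : 0 < c) (w : EuclideanSpace ℝ (Fin n)) : (c : EReal) * h w ≠ ⊥ := by
      simp [EReal.mul_ne_bot, hbot w, hc.le]
    rcases eq_or_ne (h x) ⊤ with hx | hx
    · rw [hx, EReal.coe_mul_top_of_pos ha, EReal.top_add_of_ne_bot (hmul hb y)]
      exact le_top
    rcases eq_or_ne (h y) ⊤ with hy | hy
    · rw [hy, EReal.coe_mul_top_of_pos hb, EReal.add_top_of_ne_bot (hmul ha x)]
      exact le_top
    · have hz := hconv.1 hx.lt_top hy.lt_top ha.le hb.le hab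
      rw [← EReal.coe_toReal hx (hbot x), ← EReal.coe_toReal hy (hbot y),
        ← EReal.coe_toReal hz.ne (hbot _)]
      exact_mod_cast hconv.2 hx.lt_top hy.lt_top ha.le hb.le hab

theorem const_mul (hh : ProperLscConvex h) {c : ℝ} (hc : 0 < c) :
    ProperLscConvex fun x => (c : EReal) * h x := by
  refine of_convexOn_toReal (fun x => ?_) ?_ ?_ ?_
  · simp [EReal.mul_ne_bot, hh.ne_bot x, hc.le]
  · simpa only [coe_mul_lt_top_iff_of_pos hc] using hh.dom_nonempty
  · have hcont : Continuous fun a : EReal => (c : EReal) * a :=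
      continuous_iff_continuousAt.2 fun a =>
        EReal.Tendsto.const_mul tendsto_id (by simp) (by simp)
    exact hcont.comp_lowerSemicontinuous hh.lsc fun a b hab =>
      mul_le_mul_of_nonneg_left hab (EReal.coe_nonneg.2 hc.le)
  · simpa only [coe_mul_lt_top_iff_of_pos hc, EReal.toReal_mul, EReal.toReal_coe,
      smul_eq_mul] using hh.convexOn_toReal.smul hc.le

theorem add_lt_top_iff (hh : ProperLscConvex h) (hk : ProperLscConvex k)
    {x : EuclideanSpace ℝ (Fin n)} : h x + k x < ⊤ ↔ h x < ⊤ ∧ k x < ⊤ := by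
  simp only [lt_top_iff_ne_top, EReal.add_ne_top_iff_ne_top₂ (hh.ne_bot x) (hk.ne_bot x)]

theorem toReal_add (hh : ProperLscConvex h) (hk : ProperLscConvex k)
    {x : EuclideanSpace ℝ (Fin n)} (hx : h x < ⊤) (kx : k x < ⊤) :
    (h x + k x).toReal = (h x).toReal + (k x).toReal :=
  EReal.toReal_add hx.ne (hh.ne_bot x) kx.ne (hk.ne_bot x)

theorem add (hh : ProperLscConvex h) (hk : ProperLscConvex k) (hdom : ∃ x, h x < ⊤ ∧ k x < ⊤) :
    ProperLscConvex fun x => h x + k x := by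
  have hdom_eq : {x | h x + k x < ⊤} = {x | h x < ⊤} ∩ {x | k x < ⊤} := by
    ext x
    exact hh.add_lt_top_iff hk
  refine of_convexOn_toReal (fun x => EReal.add_ne_bot_iff.2 ⟨hh.ne_bot x, hk.ne_bot x⟩)
    (hdom.imp fun x hx => (hh.add_lt_top_iff hk).2 hx) ?_ ?_
  · exact hh.lsc.add' hk.lsc fun x =>
      EReal.continuousAt_add (.inr (hk.ne_bot x)) (.inl (hh.ne_bot x))
  · have hconv : Convex ℝ ({x | h x < ⊤} ∩ {x | k x < ⊤}) :=
      hh.convexOn_toReal.1.inter hk.convexOn_toReal.1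
    rw [hdom_eq]
    refine ((hh.convexOn_toReal.subset Set.inter_subset_left hconv).add
      (hk.convexOn_toReal.subset Set.inter_subset_right hconv)).congr fun x hx => ?_
    exact (hh.toReal_add hk hx.1 hx.2).symm

theorem lowerSemicontinuous_add_coe (hh : ProperLscConvex h) {q : EuclideanSpace ℝ (Fin n) → ℝ}
    (hq : Continuous q) : LowerSemicontinuous fun w => h w + (q w : EReal) :=
  hh.lsc.add' (continuous_coe_real_ereal.comp hq).lowerSemicontinuous fun x =>
    EReal.continuousAt_add (.inr (EReal.coe_ne_bot _)) (.inl (hh.ne_bot x))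

theorem exists_toReal_sub_le (hh : ProperLscConvex h) {w : EuclideanSpace ℝ (Fin n)}
    (hw : h w < ⊤) : ∃ C : ℝ, 0 ≤ C ∧ ∀ x, h x < ⊤ →
      (h w).toReal - (h x).toReal ≤ C * (1 + ‖x - w‖) := by
  obtain ⟨u, -, hu⟩ := (hh.lsc.lowerSemicontinuousOn _).exists_isMinOn
    ⟨w, Metric.mem_closedBall_self zero_le_one⟩ (isCompact_closedBall w 1)
  obtain ⟨m, -, hm⟩ := EReal.lt_iff_exists_real_btwn.1 (bot_lt_iff_ne_bot.2 (hh.ne_bot u))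
  have hball : ∀ z, ‖z - w‖ ≤ 1 → h z < ⊤ → m ≤ (h z).toReal := by
    intro z hz hzt
    rw [← EReal.coe_le_coe_iff, hh.coe_toReal hzt]
    exact hm.le.trans (hu (mem_closedBall_iff_norm.2 hz))
  refine ⟨max ((h w).toReal - m) 0, le_max_right _ _, fun x hx => ?_⟩
  -- `x` is pulled back into the unit ball around `w` along the segment
  set t := max 1 ‖x - w‖
  have ht1 : 1 ≤ t := le_max_left _ _
  have ht0 : 0 < t := one_pos.trans_le ht1
  have htinv : t⁻¹ ≤ 1 := inv_le_one_of_one_le₀ ht1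
  have hz := hh.convexOn_toReal.1 hx hw (inv_nonneg.2 ht0.le) (sub_nonneg.2 htinv)
    (add_sub_cancel _ _)
  have hconv := hh.convexOn_toReal.2 hx hw (inv_nonneg.2 ht0.le) (sub_nonneg.2 htinv)
    (add_sub_cancel _ _)
  have hznorm : ‖t⁻¹ • x + (1 - t⁻¹) • w - w‖ ≤ 1 := by
    rw [show t⁻¹ • x + (1 - t⁻¹) • w - w = t⁻¹ • (x - w) by module, norm_smul,
      Real.norm_of_nonneg (inv_nonneg.2 ht0.le), inv_mul_le_iff₀ ht0, mul_one]
    exact le_max_right _ _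
  have hmle := mul_le_mul_of_nonneg_left ((hball _ hznorm hz).trans hconv) ht0.le
  calc (h w).toReal - (h x).toReal ≤ ((h w).toReal - m) * t := by
        simp only [smul_eq_mul, mul_add, mul_sub, sub_mul, ← mul_assoc, mul_inv_cancel₀ ht0.ne',
          one_mul] at hmle
        linarith
    _ ≤ max ((h w).toReal - m) 0 * (1 + ‖x - w‖) := by
        gcongr
        · exact le_max_left _ _
        · exact max_le (by linarith [norm_nonneg (x - w)]) (by linarith)

theorem exists_isProx (hh : ProperLscConvex h) {α : ℝ} (hα : 0 < α)
    (y : EuclideanSpace ℝ (Fin n)) : ∃ p, IsProx α h y p := by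
  obtain ⟨w, hw⟩ := hh.dom_nonempty
  obtain ⟨C, hC0, hC⟩ := hh.exists_toReal_sub_le hw
  set Q : EuclideanSpace ℝ (Fin n) → EReal :=
    fun x => h x + ((‖x - y‖ ^ 2 / (2 * α) : ℝ) : EReal) with hQ
  set R := 2 * ‖w - y‖ + 4 * α * C + 1
  have hR0 : 0 ≤ R := by positivity
  obtain ⟨p, -, hp⟩ :=
    ((hh.lowerSemicontinuous_add_coe (q := fun x => ‖x - y‖ ^ 2 / (2 * α))
      (by fun_prop)).lowerSemicontinuousOn _).exists_isMinOn
      ⟨w, Metric.mem_closedBall_self hR0⟩ (isCompact_closedBall w R)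
  have hpw : Q p ≤ Q w := hp (Metric.mem_closedBall_self hR0)
  have hfar : ∀ x, R < ‖x - w‖ → h x < ⊤ → Q w ≤ Q x := by
    intro x hx hxt
    have htri : ‖x - w‖ - ‖w - y‖ ≤ ‖x - y‖ := by
      have := norm_sub_norm_le (x - w) (y - w)
      rwa [sub_sub_sub_cancel_right, norm_sub_rev y w] at this
    have hd := norm_nonneg (w - y)
    have hsq : (‖x - w‖ - ‖w - y‖) ^ 2 ≤ ‖x - y‖ ^ 2 :=
      pow_le_pow_left₀ (by nlinarith) htri 2
    have hgrowth : ‖w - y‖ ^ 2 + 2 * α * (C * (1 + ‖x - w‖)) ≤ ‖x - y‖ ^ 2 := by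
      nlinarith [mul_nonneg hα.le hC0]
    simp only [hQ]
    rw [← hh.coe_toReal hw, ← hh.coe_toReal hxt, ← EReal.coe_add, ← EReal.coe_add,
      EReal.coe_le_coe_iff, ← sub_le_iff_le_add', add_sub_right_comm, ← le_sub_iff_add_le,
      ← sub_div, le_div_iff₀ (by positivity)]
    nlinarith [hC x hxt]
  refine ⟨p, Set.mem_univ _, hpw.trans_lt ?_, fun x _ => ?_⟩
  · exact EReal.add_lt_top hw.ne (EReal.coe_ne_top _)
  · rcases le_or_gt ‖x - w‖ R with hx | hx
    · exact hp (mem_closedBall_iff_norm.2 hx)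
    · rcases eq_or_ne (h x) ⊤ with hxt | hxt
      · simp [hxt]
      · exact hpw.trans (hfar x hx hxt.lt_top)

end ProperLscConvex

namespace IsProx

variable {α : ℝ} {y p q w : EuclideanSpace ℝ (Fin n)}

theorem lt_top (hp : IsProx α h y p) : h p < ⊤ := by
  by_contra htop
  have hfin : h p + ((‖p - y‖ ^ 2 / (2 * α) : ℝ) : EReal) < ⊤ := hp.2.1
  rw [not_lt_top_iff.1 htop, EReal.top_add_coe] at hfin
  exact lt_irrefl _ hfin

theorem sq_norm_sub_le (hh : ProperLscConvex h) (hα : 0 < α) (hp : IsProx α h y p) (hw : h w < ⊤) :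
    ‖p - y‖ ^ 2 ≤ ‖w - y‖ ^ 2 + 2 * α * ((h w).toReal - (h p).toReal) := by
  have hmin : h p + ((‖p - y‖ ^ 2 / (2 * α) : ℝ) : EReal)
      ≤ h w + ((‖w - y‖ ^ 2 / (2 * α) : ℝ) : EReal) := hp.2.2 (Set.mem_univ w)
  rw [← hh.coe_toReal hw, ← hh.coe_toReal hp.lt_top, ← EReal.coe_add, ← EReal.coe_add,
    EReal.coe_le_coe_iff] at hmin
  have hmul := mul_le_mul_of_nonneg_left hmin (mul_pos two_pos hα).le
  rw [mul_add, mul_add, mul_div_cancel₀ _ (by positivity), mul_div_cancel₀ _ (by positivity)]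
    at hmul
  linarith

theorem inner_le (hh : ProperLscConvex h) (hα : 0 < α) (hp : IsProx α h y p) (hw : h w < ⊤) :
    inner ℝ (y - p) (w - p) ≤ α * ((h w).toReal - (h p).toReal) := by
  have hsegment : ∀ t ∈ Set.Ioo (0 : ℝ) 1,
      inner ℝ (y - p) (w - p) ≤ α * ((h w).toReal - (h p).toReal) + t * (‖w - p‖ ^ 2 / 2) := by
    intro t ht
    have hz := hh.convexOn_toReal.1 hw hp.lt_top ht.1.le (sub_pos.2 ht.2).le (add_sub_cancel _ _)
    have hconv := hh.convexOn_toReal.2 hw hp.lt_top ht.1.le (sub_pos.2 ht.2).le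
      (add_sub_cancel _ _)
    have hmin := hp.sq_norm_sub_le hh hα hz
    have hexpand : ‖t • w + (1 - t) • p - y‖ ^ 2
        = t ^ 2 * ‖w - p‖ ^ 2 - 2 * (t * inner ℝ (y - p) (w - p)) + ‖p - y‖ ^ 2 := by
      rw [show t • w + (1 - t) • p - y = t • (w - p) - (y - p) by module, norm_sub_sq_real,
        norm_smul, real_inner_smul_left, real_inner_comm, norm_sub_rev y p, mul_pow,
        Real.norm_eq_abs, sq_abs]
    refine le_of_mul_le_mul_left ?_ ht.1
    simp only [smul_eq_mul] at hconv
    nlinarith [mul_le_mul_of_nonneg_left hconv hα.le]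
  have hlim : Tendsto (fun t : ℝ => α * ((h w).toReal - (h p).toReal) + t * (‖w - p‖ ^ 2 / 2))
      (𝓝[>] 0) (𝓝 (α * ((h w).toReal - (h p).toReal))) :=
    (Continuous.tendsto' (by fun_prop) _ _ (by simp)).mono_left nhdsWithin_le_nhds
  exact ge_of_tendsto hlim (eventually_of_mem (Ioo_mem_nhdsGT one_pos) hsegment)

theorem unique (hh : ProperLscConvex h) (hα : 0 < α) (hp : IsProx α h y p)
    (hq : IsProx α h y q) : p = q := by
  have hpq := hp.inner_le hh hα hq.lt_top
  have hqp := hq.inner_le hh hα hp.lt_top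
  have hsum : inner ℝ (y - p) (q - p) + inner ℝ (y - q) (p - q) = ‖p - q‖ ^ 2 := by
    rw [← neg_sub p q, inner_neg_right, neg_add_eq_sub, ← inner_sub_left, sub_sub_sub_cancel_left,
      real_inner_self_eq_norm_sq]
  have hsq : ‖p - q‖ ^ 2 ≤ 0 := by linarith
  rwa [sq_nonpos_iff, norm_eq_zero, sub_eq_zero] at hsq

theorem norm_sub_le (hh : ProperLscConvex h) (hα : 0 < α) (hp : IsProx α h y p) (hw : h w < ⊤)
    {C : ℝ} (hC0 : 0 ≤ C) (hC : (h w).toReal - (h p).toReal ≤ C * (1 + ‖p - w‖)) :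
    ‖p - w‖ ≤ ‖y - w‖ + 2 * (α * C) + 1 := by
  have hvar := (hp.inner_le hh hα hw).trans (mul_le_mul_of_nonneg_left hC hα.le)
  have hexpand : inner ℝ (y - p) (w - p) = ‖p - w‖ ^ 2 - inner ℝ (y - w) (p - w) := by
    rw [← neg_sub p w, ← sub_sub_sub_cancel_right y p w, inner_neg_right, inner_sub_left,
      real_inner_self_eq_norm_sq]
    ring
  have hcs := real_inner_le_norm (y - w) (p - w)
  have hαC := mul_nonneg hα.le hC0
  by_contra! hfar
  nlinarith [norm_nonneg (y - w)]

end IsProx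

end Prox

section SublevelSets

theorem exists_pos_forall_lt_of_isCompact {X : Type*} [TopologicalSpace X] {D K : Set X} {ψ : X → ℝ}
    (hclosed : ∀ c, IsClosed {x ∈ D | ψ x ≤ c}) (hK : IsCompact K)
    (hdisj : Disjoint K {x ∈ D | ψ x ≤ 0}) : ∃ δ > 0, ∀ x ∈ K, x ∈ D → δ < ψ x := by
  have hinter : K ∩ ⋂ δ : Set.Ioi (0 : ℝ), {x ∈ D | ψ x ≤ δ} = ∅ := by
    refine Set.eq_empty_of_forall_notMem fun x hx => Set.disjoint_left.1 hdisj hx.1 ?_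
    have hmem : ∀ δ : ℝ, 0 < δ → x ∈ D ∧ ψ x ≤ δ := fun δ hδ => Set.mem_iInter.1 hx.2 ⟨δ, hδ⟩
    exact ⟨(hmem 1 one_pos).1, le_of_forall_pos_le_add fun δ hδ => by simpa using (hmem δ hδ).2⟩
  have hmono : Monotone fun δ : Set.Ioi (0 : ℝ) => {x ∈ D | ψ x ≤ δ} :=
    fun _ _ hle x hx => ⟨hx.1, hx.2.trans hle⟩
  obtain ⟨δ, hδ⟩ := hK.elim_directed_family_closed (fun δ : Set.Ioi (0 : ℝ) => {x ∈ D | ψ x ≤ δ})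
    (fun δ => hclosed δ) hinter hmono.directed_ge
  exact ⟨δ, δ.2, fun x hxK hxD => not_le.1 fun hle =>
    Set.eq_empty_iff_forall_notMem.1 hδ x ⟨hxK, hxD, hle⟩⟩

variable {E : Type*} [NormedAddCommGroup E] [NormedSpace ℝ E] [ProperSpace E] {D : Set E}
  {ψ : E → ℝ}

theorem isBounded_sublevel_of_convexOn (hconv : ConvexOn ℝ D ψ)
    (hclosed : ∀ c, IsClosed {x ∈ D | ψ x ≤ c}) (hne : {x ∈ D | ψ x ≤ 0}.Nonempty)
    (hbdd : Bornology.IsBounded {x ∈ D | ψ x ≤ 0}) (c : ℝ) :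
    Bornology.IsBounded {x ∈ D | ψ x ≤ c} := by
  obtain ⟨z, hzD, hz⟩ := hne
  obtain ⟨r, hr0, hr⟩ := hbdd.subset_ball_lt 0 z
  have hdisj : Disjoint (Metric.sphere z r) {x ∈ D | ψ x ≤ 0} :=
    Metric.sphere_disjoint_ball.mono_right hr
  obtain ⟨δ, hδ, hsphere⟩ := exists_pos_forall_lt_of_isCompact hclosed (isCompact_sphere z r) hdisj
  refine Metric.isBounded_closedBall.subset (t := Metric.closedBall z (max r (r * c / δ))) ?_
  rintro x ⟨hxD, hx⟩
  rw [mem_closedBall_iff_norm, le_max_iff, or_iff_not_imp_left, not_le]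
  intro hfar
  have hs0 : 0 < ‖x - z‖ := hr0.trans hfar
  have ht0 : 0 ≤ r / ‖x - z‖ := by positivity
  have ht1 : 0 ≤ 1 - r / ‖x - z‖ := sub_nonneg.2 (div_le_one_of_le₀ hfar.le hs0.le)
  have hmem : (r / ‖x - z‖) • x + (1 - r / ‖x - z‖) • z ∈ Metric.sphere z r := by
    rw [mem_sphere_iff_norm, show ∀ t : ℝ, t • x + (1 - t) • z - z = t • (x - z) by intro t; module,
      norm_smul, Real.norm_of_nonneg ht0, div_mul_cancel₀ _ hs0.ne']
  have hlt : δ < r / ‖x - z‖ * c :=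
    calc δ < ψ ((r / ‖x - z‖) • x + (1 - r / ‖x - z‖) • z) :=
          hsphere _ hmem (hconv.1 hxD hzD ht0 ht1 (add_sub_cancel _ _))
      _ ≤ (r / ‖x - z‖) • ψ x + (1 - r / ‖x - z‖) • ψ z :=
          hconv.2 hxD hzD ht0 ht1 (add_sub_cancel _ _)
      _ ≤ r / ‖x - z‖ * c := by
          have := mul_nonpos_of_nonneg_of_nonpos ht1 hz
          have := mul_le_mul_of_nonneg_left hx ht0
          simp only [smul_eq_mul]
          linarith
  rw [le_div_iff₀ hδ, mul_comm]
  rw [div_mul_eq_mul_div, lt_div_iff₀ hs0] at hlt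
  exact hlt.le

theorem exists_pos_sublevel_subset_thickening (hconv : ConvexOn ℝ D ψ)
    (hclosed : ∀ c, IsClosed {x ∈ D | ψ x ≤ c}) (hne : {x ∈ D | ψ x ≤ 0}.Nonempty)
    (hbdd : Bornology.IsBounded {x ∈ D | ψ x ≤ 0}) {ε : ℝ} (hε : 0 < ε) :
    ∃ δ > 0, {x ∈ D | ψ x ≤ δ} ⊆ Metric.thickening ε {x ∈ D | ψ x ≤ 0} := by
  have hK : IsCompact ({x ∈ D | ψ x ≤ 1} \ Metric.thickening ε {x ∈ D | ψ x ≤ 0}) :=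
    (Metric.isCompact_of_isClosed_isBounded (hclosed 1)
      (isBounded_sublevel_of_convexOn hconv hclosed hne hbdd 1)).diff Metric.isOpen_thickening
  obtain ⟨δ, hδ, hgap⟩ := exists_pos_forall_lt_of_isCompact hclosed hK
    (Set.disjoint_sdiff_left.mono_right (Metric.self_subset_thickening hε _))
  refine ⟨min δ 1, by positivity, fun x ⟨hxD, hx⟩ => ?_⟩
  by_contra hxε
  exact (hgap x ⟨⟨hxD, hx.trans (min_le_right _ _)⟩, hxε⟩ hxD).not_ge (hx.trans (min_le_left _ _))

end SublevelSets

namespace BilevelProblem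

variable {n : ℕ} (P : BilevelProblem n)

/-- The common domain of the two costs. -/
def dom : Set (EuclideanSpace ℝ (Fin n)) := {x | P.g₁ x < ⊤ ∧ P.g₂ x < ⊤}

/-- The upper level cost as a real function, meaningful on the domain: outside it, the value `⊤`
of the nonsmooth part is read as `0`. -/
def val₁ (x : EuclideanSpace ℝ (Fin n)) : ℝ := P.f₁ x + (P.g₁ x).toReal

/-- The lower level cost as a real function, meaningful on the domain. -/
def val₂ (x : EuclideanSpace ℝ (Fin n)) : ℝ := P.f₂ x + (P.g₂ x).toReal

/-- The inversely penalized cost `φ_σ = σ φ₁ + φ₂` as a real function, meaningful on the domain. -/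
def val (σ : ℝ) (x : EuclideanSpace ℝ (Fin n)) : ℝ := σ * P.val₁ x + P.val₂ x

/-- The larger of the two suboptimalities of `x` relative to `xs`, used when `xs` solves the
bilevel problem: its sublevel sets are the level sets through which solutions are localized. -/
def maxGap (xs x : EuclideanSpace ℝ (Fin n)) : ℝ :=
  max (P.val₁ x - P.val₁ xs) (P.val₂ x - P.val₂ xs)

variable {P} {σ : ℝ} {x y xs : EuclideanSpace ℝ (Fin n)}

section SmoothPart

theorem differentiable_f₁ (hP : P.BasicAssumption) : Differentiable ℝ P.f₁ :=
  hP.f₁_contDiff.differentiable one_ne_zero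

theorem differentiable_f₂ (hP : P.BasicAssumption) : Differentiable ℝ P.f₂ :=
  hP.f₂_contDiff.differentiable one_ne_zero

theorem differentiable_f (hP : P.BasicAssumption) (σ : ℝ) : Differentiable ℝ (P.f σ) :=
  ((differentiable_f₁ hP).const_mul σ).add (differentiable_f₂ hP)

theorem convexOn_f (hP : P.BasicAssumption) (hσ : 0 ≤ σ) : ConvexOn ℝ Set.univ (P.f σ) :=
  (hP.f₁_convex.smul hσ).add hP.f₂_convex

theorem gradient_f (hP : P.BasicAssumption) (σ : ℝ) (x : EuclideanSpace ℝ (Fin n)) :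
    ∇ (P.f σ) x = σ • ∇ P.f₁ x + ∇ P.f₂ x := by
  have hf : HasFDerivAt (P.f σ) (σ • fderiv ℝ P.f₁ x + fderiv ℝ P.f₂ x) x :=
    ((differentiable_f₁ hP x).hasFDerivAt.const_mul σ).add (differentiable_f₂ hP x).hasFDerivAt
  rw [gradient, hf.fderiv, map_add, map_smulₛₗ, gradient, gradient]
  simp

end SmoothPart

section Values

theorem lt_top_of_cost₁_lt_top (hx : P.cost₁ x < ⊤) : P.g₁ x < ⊤ := by
  by_contra htop
  rw [cost₁, not_lt_top_iff.1 htop, EReal.coe_add_top] at hx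
  exact lt_irrefl _ hx

theorem lt_top_of_cost₂_lt_top (hx : P.cost₂ x < ⊤) : P.g₂ x < ⊤ := by
  by_contra htop
  rw [cost₂, not_lt_top_iff.1 htop, EReal.coe_add_top] at hx
  exact lt_irrefl _ hx

theorem cost₁_eq (hP : P.BasicAssumption) (hx : P.g₁ x < ⊤) : P.cost₁ x = (P.val₁ x : EReal) := by
  rw [cost₁, val₁, EReal.coe_add, hP.g₁_proper.coe_toReal hx]

theorem cost₂_eq (hP : P.BasicAssumption) (hx : P.g₂ x < ⊤) : P.cost₂ x = (P.val₂ x : EReal) := by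
  rw [cost₂, val₂, EReal.coe_add, hP.g₂_proper.coe_toReal hx]

theorem lowerSemicontinuous_cost₁ (hP : P.BasicAssumption) : LowerSemicontinuous P.cost₁ := by
  have hlsc := hP.g₁_proper.lowerSemicontinuous_add_coe hP.f₁_contDiff.continuous
  simp only [add_comm] at hlsc
  exact hlsc

theorem lowerSemicontinuous_cost₂ (hP : P.BasicAssumption) : LowerSemicontinuous P.cost₂ := by
  have hlsc := hP.g₂_proper.lowerSemicontinuous_add_coe hP.f₂_contDiff.continuous
  simp only [add_comm] at hlsc
  exact hlsc

theorem convex_dom (hP : P.BasicAssumption) : Convex ℝ P.dom :=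
  hP.g₁_proper.convexOn_toReal.1.inter hP.g₂_proper.convexOn_toReal.1

theorem convexOn_val₁ (hP : P.BasicAssumption) : ConvexOn ℝ P.dom P.val₁ :=
  (hP.f₁_convex.subset (Set.subset_univ _) (convex_dom hP)).add
    (hP.g₁_proper.convexOn_toReal.subset (fun _ hx => hx.1) (convex_dom hP))

theorem convexOn_val₂ (hP : P.BasicAssumption) : ConvexOn ℝ P.dom P.val₂ :=
  (hP.f₂_convex.subset (Set.subset_univ _) (convex_dom hP)).add
    (hP.g₂_proper.convexOn_toReal.subset (fun _ hx => hx.2) (convex_dom hP))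

theorem exists_le_val₁ (hP : P.BasicAssumption) : ∃ m : ℝ, ∀ x ∈ P.dom, m ≤ P.val₁ x := by
  obtain ⟨m, -, hm⟩ := EReal.lt_iff_exists_real_btwn.1 hP.cost₁_lower
  refine ⟨m, fun x hx => ?_⟩
  rw [← EReal.coe_le_coe_iff, ← cost₁_eq hP hx.1]
  exact hm.le.trans (iInf₂_le x hx.2)

theorem g_proper (hP : P.BasicAssumption) (hσ : 0 < σ) : ProperLscConvex (P.g σ) := by
  obtain ⟨xs, hxs⟩ := hP.X₁_nonempty
  exact (hP.g₁_proper.const_mul hσ).add hP.g₂_proper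
    ⟨xs, (coe_mul_lt_top_iff_of_pos hσ).2 (lt_top_of_cost₁_lt_top hxs.2.1),
      lt_top_of_cost₂_lt_top hxs.1.2.1⟩

theorem g_lt_top_iff (hP : P.BasicAssumption) (hσ : 0 < σ) : P.g σ x < ⊤ ↔ x ∈ P.dom := by
  rw [g, (hP.g₁_proper.const_mul hσ).add_lt_top_iff hP.g₂_proper, coe_mul_lt_top_iff_of_pos hσ]
  rfl

theorem toReal_g (hP : P.BasicAssumption) (hσ : 0 < σ) (hx : x ∈ P.dom) :
    (P.g σ x).toReal = σ * (P.g₁ x).toReal + (P.g₂ x).toReal := by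
  rw [g, (hP.g₁_proper.const_mul hσ).toReal_add hP.g₂_proper
    ((coe_mul_lt_top_iff_of_pos hσ).2 hx.1) hx.2, EReal.toReal_mul, EReal.toReal_coe]

theorem val_eq (hP : P.BasicAssumption) (hσ : 0 < σ) (hx : x ∈ P.dom) :
    P.val σ x = P.f σ x + (P.g σ x).toReal := by
  rw [toReal_g hP hσ hx, val, val₁, val₂, f]
  ring

end Values

section Solutions

theorem mem_dom_of_mem_X₁ (hxs : xs ∈ P.X₁) : xs ∈ P.dom :=
  ⟨lt_top_of_cost₁_lt_top hxs.2.1, lt_top_of_cost₂_lt_top hxs.1.2.1⟩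

theorem val₂_le_of_mem_X₁ (hP : P.BasicAssumption) (hxs : xs ∈ P.X₁) (hy : y ∈ P.dom) :
    P.val₂ xs ≤ P.val₂ y := by
  rw [← EReal.coe_le_coe_iff, ← cost₂_eq hP (mem_dom_of_mem_X₁ hxs).2, ← cost₂_eq hP hy.2]
  exact hxs.1.2.2 (Set.mem_univ y)

theorem val₁_eq_of_mem_X₁ (hP : P.BasicAssumption) (hx : x ∈ P.X₁) (hy : y ∈ P.X₁) :
    P.val₁ x = P.val₁ y := by
  rw [← EReal.coe_eq_coe_iff, ← cost₁_eq hP (mem_dom_of_mem_X₁ hx).1,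
    ← cost₁_eq hP (mem_dom_of_mem_X₁ hy).1]
  exact le_antisymm (hx.2.2 hy.1) (hy.2.2 hx.1)

theorem mem_X₁_of_val_le (hP : P.BasicAssumption) (hxs : xs ∈ P.X₁) (hx : x ∈ P.dom)
    (h₁ : P.val₁ x ≤ P.val₁ xs) (h₂ : P.val₂ x ≤ P.val₂ xs) : x ∈ P.X₁ := by
  rw [← EReal.coe_le_coe_iff, ← cost₁_eq hP (mem_dom_of_mem_X₁ hxs).1, ← cost₁_eq hP hx.1] at h₁
  rw [← EReal.coe_le_coe_iff, ← cost₂_eq hP (mem_dom_of_mem_X₁ hxs).2, ← cost₂_eq hP hx.2] at h₂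
  exact ⟨⟨Set.mem_univ _, h₂.trans_lt hxs.1.2.1, fun w hw => h₂.trans (hxs.1.2.2 hw)⟩,
    h₁.trans_lt hxs.2.1, fun w hw => h₁.trans (hxs.2.2 hw)⟩

theorem maxGap_le_iff {c : ℝ} :
    P.maxGap xs x ≤ c ↔ P.val₁ x ≤ P.val₁ xs + c ∧ P.val₂ x ≤ P.val₂ xs + c := by
  rw [maxGap, max_le_iff, sub_le_iff_le_add', sub_le_iff_le_add']

theorem setOf_maxGap_le_zero (hP : P.BasicAssumption) (hxs : xs ∈ P.X₁) :
    {x ∈ P.dom | P.maxGap xs x ≤ 0} = P.X₁ := by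
  ext x
  simp only [Set.mem_ofPred_eq, maxGap_le_iff, add_zero]
  refine ⟨fun hx => mem_X₁_of_val_le hP hxs hx.1 hx.2.1 hx.2.2, fun hx => ?_⟩
  exact ⟨mem_dom_of_mem_X₁ hx, (val₁_eq_of_mem_X₁ hP hx hxs).le,
    val₂_le_of_mem_X₁ hP hx (mem_dom_of_mem_X₁ hxs)⟩

theorem convexOn_maxGap (hP : P.BasicAssumption) (xs : EuclideanSpace ℝ (Fin n)) :
    ConvexOn ℝ P.dom (P.maxGap xs) :=
  ((convexOn_val₁ hP).sub (concaveOn_const _ (convex_dom hP))).sup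
    ((convexOn_val₂ hP).sub (concaveOn_const _ (convex_dom hP)))

theorem isClosed_setOf_maxGap_le (hP : P.BasicAssumption) (xs : EuclideanSpace ℝ (Fin n))
    (c : ℝ) : IsClosed {x ∈ P.dom | P.maxGap xs x ≤ c} := by
  convert ((lowerSemicontinuous_cost₁ hP).isClosed_preimage ((P.val₁ xs + c : ℝ) : EReal)).inter
    ((lowerSemicontinuous_cost₂ hP).isClosed_preimage ((P.val₂ xs + c : ℝ) : EReal)) using 1
  ext x
  simp only [Set.mem_ofPred_eq, Set.mem_inter_iff, Set.mem_preimage, Set.mem_Iic, maxGap_le_iff]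
  refine ⟨fun ⟨hx, h₁, h₂⟩ => ?_, fun ⟨h₁, h₂⟩ => ?_⟩
  · rw [cost₁_eq hP hx.1, cost₂_eq hP hx.2, EReal.coe_le_coe_iff, EReal.coe_le_coe_iff]
    exact ⟨h₁, h₂⟩
  · have hx : x ∈ P.dom := ⟨lt_top_of_cost₁_lt_top (h₁.trans_lt (EReal.coe_lt_top _)),
      lt_top_of_cost₂_lt_top (h₂.trans_lt (EReal.coe_lt_top _))⟩
    rw [cost₁_eq hP hx.1, EReal.coe_le_coe_iff] at h₁
    rw [cost₂_eq hP hx.2, EReal.coe_le_coe_iff] at h₂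
    exact ⟨hx, h₁, h₂⟩

theorem isBounded_setOf_maxGap_le (hP : P.BasicAssumption) (hxs : xs ∈ P.X₁) (c : ℝ) :
    Bornology.IsBounded {x ∈ P.dom | P.maxGap xs x ≤ c} := by
  have hX₁ := setOf_maxGap_le_zero hP hxs
  refine isBounded_sublevel_of_convexOn (convexOn_maxGap hP xs) (isClosed_setOf_maxGap_le hP xs)
    ?_ ?_ c
  · rw [hX₁]
    exact ⟨xs, hxs⟩
  · rw [hX₁]
    exact hP.X₁_compact.isBounded

theorem exists_pos_setOf_maxGap_le_subset (hP : P.BasicAssumption) (hxs : xs ∈ P.X₁) {ε : ℝ}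
    (hε : 0 < ε) : ∃ δ > 0, {x ∈ P.dom | P.maxGap xs x ≤ δ} ⊆ Metric.thickening ε P.X₁ := by
  have hX₁ := setOf_maxGap_le_zero hP hxs
  rw [← hX₁]
  refine exists_pos_sublevel_subset_thickening (convexOn_maxGap hP xs)
    (isClosed_setOf_maxGap_le hP xs) ?_ ?_ hε
  · rw [hX₁]
    exact ⟨xs, hxs⟩
  · rw [hX₁]
    exact hP.X₁_compact.isBounded

end Solutions

end BilevelProblem

section LipschitzEstimate

variable {n : ℕ} {F : EuclideanSpace ℝ (Fin n) → ℝ}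

theorem lipEst_mul_sq_norm (F : EuclideanSpace ℝ (Fin n) → ℝ) (u v : EuclideanSpace ℝ (Fin n)) :
    lipEst F u v * ‖u - v‖ ^ 2 = inner ℝ (∇ F u - ∇ F v) (u - v) := by
  rcases eq_or_ne u v with rfl | huv
  · simp
  · exact div_mul_cancel₀ _ (pow_ne_zero 2 (norm_ne_zero_iff.2 (sub_ne_zero.2 huv)))

theorem lipEst_nonneg (hc : ConvexOn ℝ Set.univ F) (hd : Differentiable ℝ F)
    (u v : EuclideanSpace ℝ (Fin n)) : 0 ≤ lipEst F u v :=
  div_nonneg (inner_sub_nonneg_of_convexOn_of_hasGradientAt hc (Set.mem_univ u) (Set.mem_univ v)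
    (hd u).hasGradientAt (hd v).hasGradientAt) (sq_nonneg _)

theorem lipEst_le_of_norm_sub_le {L : ℝ} (hL : 0 ≤ L) {u v : EuclideanSpace ℝ (Fin n)}
    (h : ‖∇ F u - ∇ F v‖ ≤ L * ‖u - v‖) : lipEst F u v ≤ L := by
  refine div_le_of_le_mul₀ (sq_nonneg _) hL ?_
  calc inner ℝ (∇ F u - ∇ F v) (u - v) ≤ ‖∇ F u - ∇ F v‖ * ‖u - v‖ := real_inner_le_norm _ _
    _ ≤ L * ‖u - v‖ * ‖u - v‖ := by gcongr
    _ = L * ‖u - v‖ ^ 2 := by ring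

end LipschitzEstimate

namespace BilevelProblem

variable {n : ℕ} {P : BilevelProblem n}

section ProxGradStep

variable {σ α : ℝ} {w x z : EuclideanSpace ℝ (Fin n)}

theorem exists_isProxGradStep (hP : P.BasicAssumption) (hσ : 0 < σ) (hα : 0 < α)
    (x : EuclideanSpace ℝ (Fin n)) : ∃ z, P.IsProxGradStep σ α x z :=
  (g_proper hP hσ).exists_isProx hα _

theorem IsProxGradStep.mem_dom (h : P.IsProxGradStep σ α x z) (hP : P.BasicAssumption)
    (hσ : 0 < σ) : z ∈ P.dom :=
  (g_lt_top_iff hP hσ).1 (IsProx.lt_top h)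

theorem IsProxGradStep.unique (h : P.IsProxGradStep σ α x z) (hP : P.BasicAssumption)
    (hσ : 0 < σ) (hα : 0 < α) (hw : P.IsProxGradStep σ α x w) : z = w :=
  IsProx.unique (g_proper hP hσ) hα h hw

theorem IsProxGradStep.inner_le (h : P.IsProxGradStep σ α x z) (hP : P.BasicAssumption)
    (hσ : 0 < σ) (hα : 0 < α) (hw : w ∈ P.dom) :
    inner ℝ (x - z) (w - z) ≤
      α * (inner ℝ (∇ (P.f σ) x) (w - z) + (P.g σ w).toReal - (P.g σ z).toReal) := by
  have hprox := IsProx.inner_le (g_proper hP hσ) hα h ((g_lt_top_iff hP hσ).2 hw)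
  rw [sub_right_comm, inner_sub_left, real_inner_smul_left] at hprox
  linarith

theorem IsProxGradStep.half_sq_add_half_sq_le (h : P.IsProxGradStep σ α x z)
    (hP : P.BasicAssumption) (hσ : 0 < σ) (hα : 0 < α) (hw : w ∈ P.dom) :
    ‖z - w‖ ^ 2 / 2 + ‖z - x‖ ^ 2 / 2 ≤ ‖x - w‖ ^ 2 / 2 +
      α * (P.val σ w - (P.f σ x + inner ℝ (∇ (P.f σ) x) (z - x) + (P.g σ z).toReal)) := by
  have hconvex : P.f σ x + inner ℝ (∇ (P.f σ) x) (w - x) ≤ P.f σ w :=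
    add_inner_le_of_convexOn_of_hasGradientAt (convexOn_f hP hσ.le) (Set.mem_univ x)
      (Set.mem_univ w) (differentiable_f hP σ x).hasGradientAt
  have hpolar : ‖x - w‖ ^ 2 = ‖z - x‖ ^ 2 - 2 * inner ℝ (x - z) (w - z) + ‖z - w‖ ^ 2 := by
    rw [← sub_sub_sub_cancel_right x w z, norm_sub_sq_real, norm_sub_rev x z, norm_sub_rev w z]
  have hsplit : inner ℝ (∇ (P.f σ) x) (w - z)
      = inner ℝ (∇ (P.f σ) x) (w - x) - inner ℝ (∇ (P.f σ) x) (z - x) := by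
    rw [← inner_sub_right, sub_sub_sub_cancel_right]
  have hprox := h.inner_le hP hσ hα hw
  have hscaled := mul_le_mul_of_nonneg_left hconvex hα.le
  rw [hsplit] at hprox
  rw [val_eq hP hσ hw]
  linarith

theorem IsProxGradStep.half_sq_le (h : P.IsProxGradStep σ α x z) (hP : P.BasicAssumption)
    (hσ : 0 < σ) (hα : 0 < α) (hw : w ∈ P.dom)
    (hdescent : α * (P.f σ z - P.f σ x - inner ℝ (∇ (P.f σ) x) (z - x)) ≤ ‖z - x‖ ^ 2 / 2) :
    ‖z - w‖ ^ 2 / 2 ≤ ‖x - w‖ ^ 2 / 2 - α * (P.val σ z - P.val σ w) := by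
  have hthree := h.half_sq_add_half_sq_le hP hσ hα hw
  rw [val_eq hP hσ (h.mem_dom hP hσ)]
  linarith

theorem IsProxGradStep.sq_sub_inner_le (h : P.IsProxGradStep σ α x z) (hP : P.BasicAssumption)
    (hσ : 0 < σ) (hα : 0 < α) (hx : x ∈ P.dom) :
    ‖x - z‖ ^ 2 - α * inner ℝ (∇ (P.f σ) x - ∇ (P.f σ) z) (x - z) ≤
      α * (P.val σ x - P.val σ z) := by
  have hconvex : P.f σ z + inner ℝ (∇ (P.f σ) z) (x - z) ≤ P.f σ x :=
    add_inner_le_of_convexOn_of_hasGradientAt (convexOn_f hP hσ.le) (Set.mem_univ z)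
      (Set.mem_univ x) (differentiable_f hP σ z).hasGradientAt
  have hprox := h.inner_le hP hσ hα hx
  have hscaled := mul_le_mul_of_nonneg_left hconvex hα.le
  rw [real_inner_self_eq_norm_sq] at hprox
  rw [inner_sub_left, val_eq hP hσ hx, val_eq hP hσ (h.mem_dom hP hσ)]
  linarith

theorem IsProxGradStep.one_sub_mul_sq_le {ν : ℝ} (h : P.IsProxGradStep σ α x z)
    (hP : P.BasicAssumption) (hσ : 0 < σ) (hα : 0 < α) (hx : x ∈ P.dom)
    (htest : α * lipEst (P.f σ) x z ≤ ν) :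
    (1 - ν) * ‖x - z‖ ^ 2 ≤ α * (P.val σ x - P.val σ z) := by
  have hdecrease := h.sq_sub_inner_le hP hσ hα hx
  have hscaled := mul_le_mul_of_nonneg_right htest (sq_nonneg ‖x - z‖)
  rw [← lipEst_mul_sq_norm] at hdecrease
  linarith

theorem IsProxGradStep.val_le (h : P.IsProxGradStep σ α x z) (hP : P.BasicAssumption)
    (hσ : 0 < σ) (hα : 0 < α) (hx : x ∈ P.dom) (htest : α * lipEst (P.f σ) x z ≤ 1) :
    P.val σ z ≤ P.val σ x := by
  have hdecrease := h.one_sub_mul_sq_le hP hσ hα hx htest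
  rw [sub_self, zero_mul] at hdecrease
  exact sub_nonneg.1 (nonneg_of_mul_nonneg_right hdecrease hα)

theorem IsProxGradStep.half_sq_le_of_lipschitzWith {L : ℝ≥0} (h : P.IsProxGradStep σ α x z)
    (hP : P.BasicAssumption) (hσ : 0 < σ) (hα : 0 < α) (hw : w ∈ P.dom)
    (hL : LipschitzWith L (∇ (P.f σ))) (hαL : α * L ≤ 1) :
    ‖z - w‖ ^ 2 / 2 ≤ ‖x - w‖ ^ 2 / 2 - α * (P.val σ z - P.val σ w) := by
  refine h.half_sq_le hP hσ hα hw ?_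
  have hdescent := le_add_inner_gradient_add_of_lipschitzWith (differentiable_f hP σ) hL x z
  calc α * (P.f σ z - P.f σ x - inner ℝ (∇ (P.f σ) x) (z - x))
      ≤ α * (L / 2 * ‖z - x‖ ^ 2) := by
        gcongr
        linarith
    _ = α * L * (‖z - x‖ ^ 2 / 2) := by ring
    _ ≤ ‖z - x‖ ^ 2 / 2 := mul_le_of_le_one_left (by positivity) hαL

end ProxGradStep

section UniformBounds

theorem exists_norm_gradient_f_sub_le (hP : P.BasicAssumption) {s : ℝ} (hs : 0 ≤ s) (R : ℝ) :
    ∃ L : ℝ, 0 < L ∧ ∀ σ u v, 0 ≤ σ → σ ≤ s → ‖u‖ ≤ R → ‖v‖ ≤ R →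
      ‖∇ (P.f σ) u - ∇ (P.f σ) v‖ ≤ L * ‖u - v‖ := by
  have hball := isCompact_closedBall (0 : EuclideanSpace ℝ (Fin n)) R
  obtain ⟨L₁, hL₁⟩ :=
    hP.f₁_locallyLipschitz.locallyLipschitzOn.exists_lipschitzOnWith_of_compact hball
  obtain ⟨L₂, hL₂⟩ :=
    hP.f₂_locallyLipschitz.locallyLipschitzOn.exists_lipschitzOnWith_of_compact hball
  refine ⟨s * L₁ + L₂ + 1, by positivity, fun σ u v hσ hσs hu hv => ?_⟩
  rw [← mem_closedBall_zero_iff] at hu hv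
  have hLip₁ := hL₁.norm_sub_le hu hv
  have hLip₂ := hL₂.norm_sub_le hu hv
  calc ‖∇ (P.f σ) u - ∇ (P.f σ) v‖
      = ‖σ • (∇ P.f₁ u - ∇ P.f₁ v) + (∇ P.f₂ u - ∇ P.f₂ v)‖ := by
        rw [gradient_f hP, gradient_f hP]
        congr 1
        module
    _ ≤ σ * ‖∇ P.f₁ u - ∇ P.f₁ v‖ + ‖∇ P.f₂ u - ∇ P.f₂ v‖ := by
        grw [norm_add_le, norm_smul, Real.norm_of_nonneg hσ]
    _ ≤ s * (L₁ * ‖u - v‖) + L₂ * ‖u - v‖ := by gcongr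
    _ ≤ (s * L₁ + L₂ + 1) * ‖u - v‖ := by linarith [norm_nonneg (u - v)]

theorem exists_norm_gradient_f_le (hP : P.BasicAssumption) (s K : ℝ) :
    ∃ N : ℝ, ∀ σ x, 0 ≤ σ → σ ≤ s → ‖x‖ ≤ K → ‖∇ (P.f σ) x‖ ≤ N := by
  have hcont : Continuous fun p : ℝ × EuclideanSpace ℝ (Fin n) => ∇ (P.f p.1) p.2 := by
    simp only [gradient_f hP]
    exact (continuous_fst.smul (hP.f₁_locallyLipschitz.continuous.comp continuous_snd)).add
      (hP.f₂_locallyLipschitz.continuous.comp continuous_snd)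
  obtain ⟨N, hN⟩ := ((isCompact_Icc (a := (0 : ℝ)) (b := s)).prod
    (isCompact_closedBall (0 : EuclideanSpace ℝ (Fin n)) K)).exists_bound_of_continuousOn
      hcont.continuousOn
  exact ⟨N, fun σ x hσ hσs hx => hN (σ, x) ⟨⟨hσ, hσs⟩, mem_closedBall_zero_iff.2 hx⟩⟩

theorem exists_toReal_g_sub_le (hP : P.BasicAssumption) {xs : EuclideanSpace ℝ (Fin n)}
    (hxs : xs ∈ P.dom) {s : ℝ} (hs : 0 ≤ s) :
    ∃ C : ℝ, 0 ≤ C ∧ ∀ σ x, 0 < σ → σ ≤ s → x ∈ P.dom →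
      (P.g σ xs).toReal - (P.g σ x).toReal ≤ C * (1 + ‖x - xs‖) := by
  obtain ⟨C₁, hC₁, hb₁⟩ := hP.g₁_proper.exists_toReal_sub_le hxs.1
  obtain ⟨C₂, hC₂, hb₂⟩ := hP.g₂_proper.exists_toReal_sub_le hxs.2
  refine ⟨s * C₁ + C₂, by positivity, fun σ x hσ hσs hx => ?_⟩
  rw [toReal_g hP hσ hxs, toReal_g hP hσ hx]
  calc σ * (P.g₁ xs).toReal + (P.g₂ xs).toReal - (σ * (P.g₁ x).toReal + (P.g₂ x).toReal)
      = σ * ((P.g₁ xs).toReal - (P.g₁ x).toReal) + ((P.g₂ xs).toReal - (P.g₂ x).toReal) := by ring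
    _ ≤ σ * (C₁ * (1 + ‖x - xs‖)) + C₂ * (1 + ‖x - xs‖) := by
        gcongr
        exacts [hb₁ x hx.1, hb₂ x hx.2]
    _ ≤ s * (C₁ * (1 + ‖x - xs‖)) + C₂ * (1 + ‖x - xs‖) := by gcongr
    _ = (s * C₁ + C₂) * (1 + ‖x - xs‖) := by ring

theorem exists_norm_le_of_isProxGradStep (hP : P.BasicAssumption) {s : ℝ} (hs : 0 ≤ s)
    (A K : ℝ) :
    ∃ R : ℝ, ∀ σ a x z, 0 < σ → σ ≤ s → 0 < a → a ≤ A → ‖x‖ ≤ K →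
      P.IsProxGradStep σ a x z → ‖z‖ ≤ R := by
  obtain ⟨xs, hxs⟩ := hP.X₁_nonempty
  have hdom := mem_dom_of_mem_X₁ hxs
  obtain ⟨C, hC₀, hC⟩ := exists_toReal_g_sub_le hP hdom hs
  obtain ⟨N, hN⟩ := exists_norm_gradient_f_le hP s K
  refine ⟨K + A * N + ‖xs‖ + 2 * (A * C) + 1 + ‖xs‖, fun σ a x z hσ hσs ha haA hx hz => ?_⟩
  have hgrad := hN σ x hσ.le hσs hx
  have hN₀ : 0 ≤ N := (norm_nonneg _).trans hgrad
  have hdist : ‖z - xs‖ ≤ ‖x - a • ∇ (P.f σ) x - xs‖ + 2 * (a * C) + 1 :=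
    IsProx.norm_sub_le (g_proper hP hσ) ha hz ((g_lt_top_iff hP hσ).2 hdom) hC₀
      (hC σ z hσ hσs (hz.mem_dom hP hσ))
  have hforward : ‖x - a • ∇ (P.f σ) x - xs‖ ≤ K + A * N + ‖xs‖ := by
    grw [norm_sub_le, norm_sub_le, norm_smul, Real.norm_of_nonneg ha.le, hx, hgrad, haA]
  calc ‖z‖ ≤ ‖z - xs‖ + ‖xs‖ := norm_le_norm_sub_add z xs
    _ ≤ K + A * N + ‖xs‖ + 2 * (A * C) + 1 + ‖xs‖ := by grw [hdist, hforward, haA]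

theorem exists_lipEst_le_of_isProxGradStep (hP : P.BasicAssumption) {s : ℝ} (hs : 0 ≤ s)
    (A K : ℝ) :
    ∃ L : ℝ, 0 < L ∧ ∀ σ a x z, 0 < σ → σ ≤ s → 0 < a → a ≤ A → ‖x‖ ≤ K →
      P.IsProxGradStep σ a x z → lipEst (P.f σ) x z ≤ L := by
  obtain ⟨R, hR⟩ := exists_norm_le_of_isProxGradStep hP hs A K
  obtain ⟨L, hL₀, hL⟩ := exists_norm_gradient_f_sub_le hP hs (max K R)
  refine ⟨L, hL₀, fun σ a x z hσ hσs ha haA hx hz => ?_⟩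
  exact lipEst_le_of_norm_sub_le hL₀.le (hL σ x z hσ.le hσs (le_max_of_le_left hx)
    (le_max_of_le_right (hR σ a x z hσ hσs ha haA hx hz)))

end UniformBounds

end BilevelProblem

section RealSequences

theorem tendsto_sum_range_succ_atTop {u : ℕ → ℝ}
    (hu : Tendsto (fun m => ∑ k ∈ Finset.range m, u k) atTop atTop) :
    Tendsto (fun m => ∑ k ∈ Finset.range m, u (k + 1)) atTop atTop := by
  have hshift : ∀ m, ∑ k ∈ Finset.range m, u (k + 1) = ∑ k ∈ Finset.range (m + 1), u k + -u 0 :=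
    fun m => by rw [Finset.sum_range_succ', add_neg_cancel_right]
  simp only [hshift]
  exact tendsto_atTop_add_const_right _ _ (hu.comp (tendsto_add_atTop_nat 1))

theorem frequently_lt_of_succ_le_sub_mul {Z τ s v : ℕ → ℝ} {c : ℝ} (hc : 0 < c)
    (hτ : ∀ k, c ≤ τ k) (hZ : ∀ k, 0 ≤ Z k) (hdecrease : ∀ k, Z (k + 1) ≤ Z k - τ k * v k)
    (hs : ∀ k, 0 ≤ s k) (hsum : Tendsto (fun m => ∑ k ∈ Finset.range m, s k) atTop atTop) :
    ∃ᶠ k in atTop, v k < s k := by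
  intro hlarge
  obtain ⟨K, hK⟩ := eventually_atTop.1 hlarge
  have htelescope : ∀ m ≥ K,
      c * ∑ k ∈ Finset.range m, s k ≤ Z K - Z m + c * ∑ k ∈ Finset.range K, s k := by
    intro m hm
    induction m, hm using Nat.le_induction with
    | base => simp
    | succ m hm ih =>
      have hterm : c * s m ≤ τ m * v m :=
        mul_le_mul (hτ m) (not_lt.1 (hK m hm)) (hs m) (hc.le.trans (hτ m))
      rw [Finset.sum_range_succ, mul_add]
      linarith [hdecrease m]
  obtain ⟨m, hmK, hm⟩ := ((eventually_ge_atTop K).and ((hsum.const_mul_atTop hc).eventually_gt_atTop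
    (Z K + c * ∑ k ∈ Finset.range K, s k))).exists
  linarith [htelescope m hmK, hZ m]

end RealSequences

/-- The inverse penalties start at a positive value and shrink by a factor of at least `3 / 4`. -/
structure IsSlowlyDecreasing (σ : ℕ → ℝ) : Prop where
  zero_pos : 0 < σ 0
  mem_Icc : ∀ k, σ (k + 1) ∈ Set.Icc (3 / 4 * σ k) (σ k)

namespace IsSlowlyDecreasing

variable {σ : ℕ → ℝ}

theorem pos (h : IsSlowlyDecreasing σ) (k : ℕ) : 0 < σ k := by
  induction k with
  | zero => exact h.zero_pos
  | succ k ih => exact lt_of_lt_of_le (by positivity) (h.mem_Icc k).1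

theorem antitone (h : IsSlowlyDecreasing σ) : Antitone σ :=
  antitone_nat_of_succ_le fun k => (h.mem_Icc k).2

end IsSlowlyDecreasing

namespace BilevelProblem

variable {n : ℕ} {P : BilevelProblem n}

/-- The penalized suboptimality `σ (φ₁ - m) + (φ₂ - φ₂(xs))`: when `m` bounds `φ₁` from below on
the domain and `xs` solves the bilevel problem, it is nonnegative and monotone in `σ`. -/
def gap (P : BilevelProblem n) (m : ℝ) (xs : EuclideanSpace ℝ (Fin n)) (σ : ℝ)
    (y : EuclideanSpace ℝ (Fin n)) : ℝ :=
  σ * (P.val₁ y - m) + (P.val₂ y - P.val₂ xs)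

section Gap

variable {m : ℝ} {xs y : EuclideanSpace ℝ (Fin n)}

theorem gap_eq (P : BilevelProblem n) (m : ℝ) (xs : EuclideanSpace ℝ (Fin n)) (σ : ℝ)
    (y : EuclideanSpace ℝ (Fin n)) :
    P.gap m xs σ y = P.val σ y - P.val σ xs + σ * (P.val₁ xs - m) := by
  rw [gap, val, val]
  ring

theorem val₂_sub_le_gap {σ : ℝ} (hm : ∀ x ∈ P.dom, m ≤ P.val₁ x) (hy : y ∈ P.dom) (hσ : 0 ≤ σ) :
    P.val₂ y - P.val₂ xs ≤ P.gap m xs σ y :=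
  le_add_of_nonneg_left (mul_nonneg hσ (sub_nonneg.2 (hm y hy)))

theorem gap_nonneg {σ : ℝ} (hP : P.BasicAssumption) (hm : ∀ x ∈ P.dom, m ≤ P.val₁ x)
    (hxs : xs ∈ P.X₁) (hy : y ∈ P.dom) (hσ : 0 ≤ σ) : 0 ≤ P.gap m xs σ y :=
  (sub_nonneg.2 (val₂_le_of_mem_X₁ hP hxs hy)).trans (val₂_sub_le_gap hm hy hσ)

theorem gap_mono {σ τ : ℝ} (hm : ∀ x ∈ P.dom, m ≤ P.val₁ x) (hy : y ∈ P.dom) (hσ : σ ≤ τ) :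
    P.gap m xs σ y ≤ P.gap m xs τ y := by
  have hnonneg := sub_nonneg.2 (hm y hy)
  unfold gap
  gcongr

theorem val_sub_le_gap_sub {σ τ : ℝ} {z : EuclideanSpace ℝ (Fin n)}
    (hm : ∀ x ∈ P.dom, m ≤ P.val₁ x) (hy : y ∈ P.dom) (hτ : τ ≤ σ) :
    P.val τ y - P.val τ z ≤ P.gap m xs σ y - P.gap m xs τ z := by
  have hmono := gap_mono (xs := xs) hm hy hτ
  rw [gap_eq P m xs τ] at hmono ⊢
  linarith

theorem tendsto_val₂_of_tendsto_gap {σ : ℕ → ℝ} {y : ℕ → EuclideanSpace ℝ (Fin n)}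
    (hP : P.BasicAssumption) (hm : ∀ x ∈ P.dom, m ≤ P.val₁ x) (hxs : xs ∈ P.X₁)
    (hy : ∀ k, y k ∈ P.dom) (hσ : ∀ k, 0 ≤ σ k)
    (hgap : Tendsto (fun k => P.gap m xs (σ k) (y k)) atTop (𝓝 0)) :
    Tendsto (fun k => P.val₂ (y k)) atTop (𝓝 (P.val₂ xs)) :=
  tendsto_sub_nhds_zero_iff.1 (squeeze_zero
    (fun k => sub_nonneg.2 (val₂_le_of_mem_X₁ hP hxs (hy k)))
    (fun k => val₂_sub_le_gap hm (hy k) (hσ k)) hgap)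

end Gap

/-- Energies `Z k xs`, one for each solution `xs`, that dominate the squared distance of `w k` to
`xs`, decrease by `τ k` times the penalized suboptimality of `y k` relative to `xs`, and are small
just after `y k` has been close to `xs`, up to an error `ω k`. -/
structure IsFejerEnergy (P : BilevelProblem n) (σ τ ω : ℕ → ℝ)
    (y w : ℕ → EuclideanSpace ℝ (Fin n)) (Z : ℕ → EuclideanSpace ℝ (Fin n) → ℝ) : Prop where
  σ_nonneg : ∀ k, 0 ≤ σ k
  τ_nonneg : ∀ k, 0 ≤ τ k
  ω_nonneg : ∀ k, 0 ≤ ω k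
  mem_dom : ∀ k, y k ∈ P.dom
  decrease : ∀ k, ∀ xs ∈ P.X₁,
    Z (k + 1) xs ≤ Z k xs - τ k * (P.val (σ k) (y k) - P.val (σ k) xs)
  lower : ∀ k, ∀ xs ∈ P.X₁, ‖w k - xs‖ ^ 2 / 2 ≤ Z k xs
  upper : ∀ k, ∀ xs ∈ P.X₁, Z (k + 1) xs ≤ (‖y k - xs‖ + ω k) ^ 2 / 2 + ω k

namespace IsFejerEnergy

variable {σ τ ω : ℕ → ℝ} {y w : ℕ → EuclideanSpace ℝ (Fin n)}
  {Z : ℕ → EuclideanSpace ℝ (Fin n) → ℝ} {xs : EuclideanSpace ℝ (Fin n)} {c m : ℝ}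

theorem nonneg (h : P.IsFejerEnergy σ τ ω y w Z) (hxs : xs ∈ P.X₁) (k : ℕ) : 0 ≤ Z k xs :=
  le_trans (by positivity) (h.lower k xs hxs)

theorem mul_val₁_sub_le (h : P.IsFejerEnergy σ τ ω y w Z) (hP : P.BasicAssumption)
    (hxs : xs ∈ P.X₁) (k : ℕ) :
    σ k * (P.val₁ (y k) - P.val₁ xs) ≤ P.val (σ k) (y k) - P.val (σ k) xs := by
  rw [val, val]
  linarith [val₂_le_of_mem_X₁ hP hxs (h.mem_dom k)]

theorem succ_le (h : P.IsFejerEnergy σ τ ω y w Z) (hP : P.BasicAssumption) (hxs : xs ∈ P.X₁)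
    {k : ℕ} (hk : P.val₁ xs ≤ P.val₁ (y k)) : Z (k + 1) xs ≤ Z k xs := by
  have hval := (mul_nonneg (h.σ_nonneg k) (sub_nonneg.2 hk)).trans (h.mul_val₁_sub_le hP hxs k)
  exact (h.decrease k xs hxs).trans (sub_le_self _ (mul_nonneg (h.τ_nonneg k) hval))

theorem exists_energy_le (h : P.IsFejerEnergy σ τ ω y w Z) (hP : P.BasicAssumption)
    (hxs : xs ∈ P.X₁) {Ω V : ℝ} (hω : ∀ k, ω k ≤ Ω) (hV : ∀ k, P.val₂ (y k) ≤ V) :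
    ∃ B : ℝ, ∀ k, Z k xs ≤ B := by
  obtain ⟨R, hR⟩ := (isBounded_setOf_maxGap_le hP hxs (V - P.val₂ xs)).exists_norm_le
  have hV₀ : P.val₂ xs ≤ V := (val₂_le_of_mem_X₁ hP hxs (h.mem_dom 0)).trans (hV 0)
  refine ⟨max (Z 0 xs) ((R + ‖xs‖ + Ω) ^ 2 / 2 + Ω), fun k => ?_⟩
  induction k with
  | zero => exact le_max_left _ _
  | succ k ih =>
    rcases le_or_gt (P.val₁ xs) (P.val₁ (y k)) with habove | hbelow
    · exact (h.succ_le hP hxs habove).trans ih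
    · have hy : ‖y k‖ ≤ R :=
        hR (y k) ⟨h.mem_dom k, maxGap_le_iff.2 ⟨by linarith, by linarith [hV k]⟩⟩
      have hR₀ : 0 ≤ R := (norm_nonneg _).trans hy
      have hωk := h.ω_nonneg k
      exact ((h.upper k xs hxs).trans (by grw [norm_sub_le, hy, hω k])).trans
        (le_max_right _ _)

theorem exists_norm_le (h : P.IsFejerEnergy σ τ ω y w Z) (hP : P.BasicAssumption) {Ω V : ℝ}
    (hω : ∀ k, ω k ≤ Ω) (hV : ∀ k, P.val₂ (y k) ≤ V) : ∃ R : ℝ, ∀ k, ‖w k‖ ≤ R := by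
  obtain ⟨xs, hxs⟩ := hP.X₁_nonempty
  obtain ⟨B, hB⟩ := h.exists_energy_le hP hxs hω hV
  refine ⟨√(2 * B) + ‖xs‖, fun k => ?_⟩
  have hdist : ‖w k - xs‖ ≤ √(2 * B) :=
    Real.le_sqrt_of_sq_le (by linarith [h.lower k xs hxs, hB k])
  exact (norm_le_norm_sub_add (w k) xs).trans (by gcongr)

theorem exists_gap_lt (h : P.IsFejerEnergy σ τ ω y w Z) (hxs : xs ∈ P.X₁)
    (hc : 0 < c) (hτ : ∀ k, c ≤ τ k) (hσ : Tendsto σ atTop (𝓝 0)) {ε : ℝ} (hε : 0 < ε) :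
    ∃ k, P.gap m xs (σ k) (y k) < ε := by
  have hshift : Tendsto (fun k => σ k * (P.val₁ xs - m)) atTop (𝓝 0) := by
    simpa using hσ.mul_const (P.val₁ xs - m)
  have hsum : Tendsto (fun m => ∑ _k ∈ Finset.range m, ε / 2) atTop atTop := by
    simpa using tendsto_natCast_atTop_atTop.atTop_mul_const (half_pos hε)
  obtain ⟨k, hval, hk⟩ := ((frequently_lt_of_succ_le_sub_mul hc hτ (h.nonneg hxs)
    (fun k => h.decrease k xs hxs) (fun _ => (half_pos hε).le) hsum).and_eventually
    (hshift.eventually_lt_const (half_pos hε))).exists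
  exact ⟨k, by rw [gap_eq]; linarith⟩

theorem tendsto_gap (h : P.IsFejerEnergy σ τ ω y w Z) (hP : P.BasicAssumption)
    (hm : ∀ x ∈ P.dom, m ≤ P.val₁ x) (hxs : xs ∈ P.X₁)
    (hanti : Antitone fun k => P.gap m xs (σ k) (y k)) (hc : 0 < c) (hτ : ∀ k, c ≤ τ k)
    (hσ : Tendsto σ atTop (𝓝 0)) :
    Tendsto (fun k => P.gap m xs (σ k) (y k)) atTop (𝓝 0) := by
  have hnonneg : ∀ k, 0 ≤ P.gap m xs (σ k) (y k) := fun k =>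
    gap_nonneg hP hm hxs (h.mem_dom k) (h.σ_nonneg k)
  refine tendsto_order.2 ⟨fun a ha => .of_forall fun k => ha.trans_le (hnonneg k), fun ε hε => ?_⟩
  obtain ⟨K, hK⟩ := h.exists_gap_lt hxs hc hτ hσ hε
  exact eventually_atTop.2 ⟨K, fun k hk => (hanti hk).trans_lt hK⟩

theorem exists_pos_eventually_exists_energy_le (h : P.IsFejerEnergy σ τ ω y w Z)
    (hP : P.BasicAssumption) (hxs : xs ∈ P.X₁) (hω : Tendsto ω atTop (𝓝 0))
    (hval₂ : Tendsto (fun k => P.val₂ (y k)) atTop (𝓝 (P.val₂ xs))) {ε : ℝ} (hε : 0 < ε) :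
    ∃ δ > 0, ∀ᶠ k in atTop, P.val₁ (y k) ≤ P.val₁ xs + δ → ∃ z ∈ P.X₁, Z (k + 1) z ≤ ε := by
  set r := min 1 (ε / 4)
  have hr₀ : 0 < r := by positivity
  have hr₁ : r ≤ 1 := min_le_left _ _
  have hrε : r ≤ ε / 4 := min_le_right _ _
  obtain ⟨δ, hδ, hthick⟩ := exists_pos_setOf_maxGap_le_subset hP hxs hr₀
  refine ⟨δ, hδ, ?_⟩
  filter_upwards [hω.eventually_lt_const hr₀,
    hval₂.eventually_le_const (lt_add_of_pos_right _ hδ)] with k hωk hk₂ hk₁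
  obtain ⟨z, hz, hyz⟩ :=
    Metric.mem_thickening_iff.1 (hthick ⟨h.mem_dom k, maxGap_le_iff.2 ⟨hk₁, hk₂⟩⟩)
  rw [dist_eq_norm] at hyz
  have hω₀ := h.ω_nonneg k
  refine ⟨z, hz, ?_⟩
  calc Z (k + 1) z ≤ (‖y k - z‖ + ω k) ^ 2 / 2 + ω k := h.upper k z hz
    _ ≤ (r + r) ^ 2 / 2 + r := by gcongr
    _ ≤ ε := by nlinarith

theorem frequently_val₁_le (h : P.IsFejerEnergy σ τ ω y w Z) (hP : P.BasicAssumption)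
    (hxs : xs ∈ P.X₁) (hc : 0 < c) (hτ : ∀ k, c ≤ τ k)
    (hσ : Tendsto (fun m => ∑ k ∈ Finset.range m, σ k) atTop atTop) {δ : ℝ} (hδ : 0 < δ) :
    ∃ᶠ k in atTop, P.val₁ (y k) ≤ P.val₁ xs + δ := by
  have hsum : Tendsto (fun m => ∑ k ∈ Finset.range m, δ * σ k) atTop atTop := by
    simpa only [Finset.mul_sum] using hσ.const_mul_atTop hδ
  refine (frequently_lt_of_succ_le_sub_mul hc hτ (h.nonneg hxs) (fun k => h.decrease k xs hxs)
    (fun k => mul_nonneg hδ.le (h.σ_nonneg k)) hsum).mono fun k hk => ?_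
  have hlt : σ k * (P.val₁ (y k) - P.val₁ xs) < σ k * δ := by
    linarith [h.mul_val₁_sub_le hP hxs k]
  linarith [lt_of_mul_lt_mul_left hlt (h.σ_nonneg k)]

theorem eventually_exists_energy_le (h : P.IsFejerEnergy σ τ ω y w Z) (hP : P.BasicAssumption)
    (hxs : xs ∈ P.X₁) (hω : Tendsto ω atTop (𝓝 0))
    (hval₂ : Tendsto (fun k => P.val₂ (y k)) atTop (𝓝 (P.val₂ xs))) (hc : 0 < c)
    (hτ : ∀ k, c ≤ τ k) (hσ : Tendsto (fun m => ∑ k ∈ Finset.range m, σ k) atTop atTop)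
    {ε : ℝ} (hε : 0 < ε) : ∀ᶠ k in atTop, ∃ z ∈ P.X₁, Z k z ≤ ε := by
  obtain ⟨δ, hδ, hnear⟩ := h.exists_pos_eventually_exists_energy_le hP hxs hω hval₂ hε
  obtain ⟨K, hK⟩ := eventually_atTop.1 hnear
  obtain ⟨k₀, hk₀, hK₀⟩ :=
    ((h.frequently_val₁_le hP hxs hc hτ hσ hδ).and_eventually (eventually_ge_atTop K)).exists
  refine eventually_atTop.2 ⟨k₀ + 1, fun k hk => ?_⟩
  induction k, hk using Nat.le_induction with
  | base => exact hK k₀ hK₀ hk₀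
  | succ k hk ih =>
    rcases le_or_gt (P.val₁ xs) (P.val₁ (y k)) with habove | hbelow
    · obtain ⟨z, hz, hzε⟩ := ih
      exact ⟨z, hz, (h.succ_le hP hz ((val₁_eq_of_mem_X₁ hP hz hxs).trans_le habove)).trans hzε⟩
    · exact hK k (by omega) (by linarith)

theorem tendsto_infDist (h : P.IsFejerEnergy σ τ ω y w Z) (hP : P.BasicAssumption)
    (hxs : xs ∈ P.X₁) (hω : Tendsto ω atTop (𝓝 0))
    (hval₂ : Tendsto (fun k => P.val₂ (y k)) atTop (𝓝 (P.val₂ xs))) (hc : 0 < c)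
    (hτ : ∀ k, c ≤ τ k) (hσ : Tendsto (fun m => ∑ k ∈ Finset.range m, σ k) atTop atTop) :
    Tendsto (fun k => Metric.infDist (w k) P.X₁) atTop (𝓝 0) := by
  refine tendsto_order.2
    ⟨fun a ha => .of_forall fun k => ha.trans_le Metric.infDist_nonneg, fun ε hε => ?_⟩
  filter_upwards [h.eventually_exists_energy_le hP hxs hω hval₂ hc hτ hσ
    (by positivity : 0 < ε ^ 2 / 4)] with k ⟨z, hz, hzε⟩
  have hsq : ‖w k - z‖ ^ 2 < ε ^ 2 := by linarith [h.lower k z hz, sq_pos_of_pos hε]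
  refine (Metric.infDist_le_dist_of_mem hz).trans_lt ?_
  rw [dist_eq_norm]
  exact lt_of_pow_lt_pow_left₀ 2 hε.le hsq

end IsFejerEnergy

section ConvergesToSolutions

variable {x : ℕ → EuclideanSpace ℝ (Fin n)}

theorem isBounded_range_of_tendsto_infDist (hP : P.BasicAssumption)
    (hx : Tendsto (fun k => Metric.infDist (x k) P.X₁) atTop (𝓝 0)) :
    Bornology.IsBounded (Set.range x) := by
  obtain ⟨b, hb⟩ := hx.bddAbove_range
  refine (hP.X₁_compact.isBounded.cthickening (δ := b)).subset ?_
  rintro _ ⟨k, rfl⟩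
  obtain ⟨z, hz, hdist⟩ := hP.X₁_compact.exists_infDist_eq_dist hP.X₁_nonempty (x k)
  exact Metric.mem_cthickening_of_dist_le _ z b _ hz (hdist ▸ hb (Set.mem_range_self k))

theorem mem_X₁_of_mapClusterPt (hP : P.BasicAssumption)
    (hx : Tendsto (fun k => Metric.infDist (x k) P.X₁) atTop (𝓝 0))
    {z : EuclideanSpace ℝ (Fin n)} (hz : MapClusterPt z atTop x) : z ∈ P.X₁ := by
  obtain ⟨s, hs, hsz⟩ := MapClusterPt.tendsto_subseq hz
  have hzero : Metric.infDist z P.X₁ = 0 :=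
    tendsto_nhds_unique (((Metric.continuous_infDist_pt P.X₁).tendsto z).comp hsz)
      (hx.comp hs.tendsto_atTop)
  rwa [hP.X₁_compact.isClosed.mem_iff_infDist_zero hP.X₁_nonempty]

theorem ConvergesToSolutions.of_tendsto_infDist (hP : P.BasicAssumption)
    (hx : Tendsto (fun k => Metric.infDist (x k) P.X₁) atTop (𝓝 0)) :
    P.ConvergesToSolutions x :=
  ⟨isBounded_range_of_tendsto_infDist hP hx, fun _ hz => mem_X₁_of_mapClusterPt hP hx hz, hx⟩

end ConvergesToSolutions

section StaBiM

variable {ν s : ℝ} {L₁ L₂ : ℝ≥0} {σ : ℕ → ℝ} {x₀ : EuclideanSpace ℝ (Fin n)}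
  {x : ℕ → EuclideanSpace ℝ (Fin n)}

theorem lipschitzWith_gradient_f (hP : P.BasicAssumption) (h₁ : LipschitzWith L₁ (∇ P.f₁))
    (h₂ : LipschitzWith L₂ (∇ P.f₂)) (s : ℝ≥0) :
    LipschitzWith (s * L₁ + L₂) (∇ (P.f s)) := by
  have hgrad : ∇ (P.f s) = fun x => (s : ℝ) • ∇ P.f₁ x + ∇ P.f₂ x :=
    funext (gradient_f hP s)
  rw [hgrad]
  refine LipschitzWith.add ?_ h₂
  simpa only [NNReal.nnnorm_eq, Function.comp_def] using (lipschitzWith_smul (s : ℝ)).comp h₁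

theorem mul_add_pos_of_add_pos (hL : 0 < L₁ + L₂) (hs : 0 < s) : 0 < s * (L₁ : ℝ) + L₂ := by
  rcases add_pos_iff.1 hL with hL₁ | hL₂
  · exact add_pos_of_pos_of_nonneg (mul_pos hs hL₁) L₂.coe_nonneg
  · exact add_pos_of_nonneg_of_pos (by positivity) hL₂

theorem exists_isStaBiM (hP : P.BasicAssumption) (hσ : ∀ k, 0 < σ k) (hν : 0 < ν)
    (hL : 0 < L₁ + L₂) (x₀ : EuclideanSpace ℝ (Fin n)) : ∃ x, P.IsStaBiM ν L₁ L₂ σ x₀ x := by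
  choose T hT using fun (k : ℕ) (u : EuclideanSpace ℝ (Fin n)) =>
    exists_isProxGradStep hP (hσ (k + 1)) (div_pos hν (mul_add_pos_of_add_pos hL (hσ (k + 1)))) u
  exact ⟨fun k => Nat.rec x₀ T k, rfl, fun k => hT k _⟩

theorem IsStaBiM.isFejerEnergy (h : P.IsStaBiM ν L₁ L₂ σ x₀ x) (hP : P.BasicAssumption)
    (hσ : ∀ k, 0 < σ k) (hν : ν ∈ Set.Ioc (0 : ℝ) 1) (h₁ : LipschitzWith L₁ (∇ P.f₁))
    (h₂ : LipschitzWith L₂ (∇ P.f₂)) (hL : 0 < L₁ + L₂) :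
    P.IsFejerEnergy (fun k => σ (k + 1)) (fun k => ν / (σ (k + 1) * L₁ + L₂)) (fun _ => 0)
      (fun k => x (k + 1)) x (fun k w => ‖x k - w‖ ^ 2 / 2) where
  σ_nonneg k := (hσ _).le
  τ_nonneg k := (div_pos hν.1 (mul_add_pos_of_add_pos hL (hσ _))).le
  ω_nonneg _ := le_rfl
  mem_dom k := (h.x_succ k).mem_dom hP (hσ _)
  decrease k w hw := by
    have hmod := mul_add_pos_of_add_pos hL (hσ (k + 1))
    refine (h.x_succ k).half_sq_le_of_lipschitzWith hP (hσ _) (div_pos hν.1 hmod)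
      (mem_dom_of_mem_X₁ hw) (lipschitzWith_gradient_f hP h₁ h₂ ⟨σ (k + 1), (hσ _).le⟩) ?_
    exact (div_mul_cancel₀ ν hmod.ne').trans_le hν.2
  lower _ _ _ := le_rfl
  upper _ _ _ := by simp

theorem IsStaBiM.val_succ_le (h : P.IsStaBiM ν L₁ L₂ σ x₀ x) (hP : P.BasicAssumption)
    (hσ : ∀ k, 0 < σ k) (hν : ν ∈ Set.Ioc (0 : ℝ) 1) (h₁ : LipschitzWith L₁ (∇ P.f₁))
    (h₂ : LipschitzWith L₂ (∇ P.f₂)) (hL : 0 < L₁ + L₂) {k : ℕ} (hx : x k ∈ P.dom) :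
    P.val (σ (k + 1)) (x (k + 1)) ≤ P.val (σ (k + 1)) (x k) := by
  have hmod := mul_add_pos_of_add_pos hL (hσ (k + 1))
  have hlip : lipEst (P.f (σ (k + 1))) (x k) (x (k + 1)) ≤ σ (k + 1) * L₁ + L₂ :=
    lipEst_le_of_norm_sub_le hmod.le
      ((lipschitzWith_gradient_f hP h₁ h₂ ⟨σ (k + 1), (hσ _).le⟩).norm_sub_le _ _)
  have hstep : 0 < ν / (σ (k + 1) * L₁ + L₂) := div_pos hν.1 hmod
  refine (h.x_succ k).val_le hP (hσ _) hstep hx ?_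
  grw [hlip, div_mul_cancel₀ ν hmod.ne', hν.2]

theorem IsStaBiM.convergesToSolutions (h : P.IsStaBiM ν L₁ L₂ σ x₀ x) (hP : P.BasicAssumption)
    (hσ : ∀ k, 0 < σ k) (hanti : Antitone σ) (hzero : Tendsto σ atTop (𝓝 0))
    (hsum : Tendsto (fun m => ∑ k ∈ Finset.range m, σ k) atTop atTop)
    (hν : ν ∈ Set.Ioc (0 : ℝ) 1) (h₁ : LipschitzWith L₁ (∇ P.f₁))
    (h₂ : LipschitzWith L₂ (∇ P.f₂)) (hL : 0 < L₁ + L₂) : P.ConvergesToSolutions x := by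
  obtain ⟨xs, hxs⟩ := hP.X₁_nonempty
  obtain ⟨m, hm⟩ := exists_le_val₁ hP
  have henergy := h.isFejerEnergy hP hσ hν h₁ h₂ hL
  have hmod := fun k => mul_add_pos_of_add_pos hL (hσ k)
  have hstep : ∀ k, ν / (σ 0 * L₁ + L₂) ≤ ν / (σ (k + 1) * L₁ + L₂) := fun k =>
    div_le_div_of_nonneg_left hν.1.le (hmod _) (by grw [hanti (Nat.zero_le (k + 1))])
  have hgap_anti : Antitone fun k => P.gap m xs (σ (k + 1)) (x (k + 1)) := by
    refine antitone_nat_of_succ_le fun k => ?_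
    have hval := h.val_succ_le hP hσ hν h₁ h₂ hL (henergy.mem_dom k)
    have hgap := val_sub_le_gap_sub (xs := xs) (z := x (k + 2)) hm (henergy.mem_dom k)
      (hanti (Nat.le_succ (k + 1)))
    linarith
  have hgap := henergy.tendsto_gap hP hm hxs hgap_anti (div_pos hν.1 (hmod 0)) hstep
    (hzero.comp (tendsto_add_atTop_nat 1))
  have hval₂ := tendsto_val₂_of_tendsto_gap hP hm hxs henergy.mem_dom henergy.σ_nonneg hgap
  exact .of_tendsto_infDist hP (henergy.tendsto_infDist hP hxs tendsto_const_nhds hval₂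
    (div_pos hν.1 (hmod 0)) hstep (tendsto_sum_range_succ_atTop hsum))

end StaBiM

end BilevelProblem

section Estimates

variable {n : ℕ} {F : EuclideanSpace ℝ (Fin n) → ℝ} {α : ℝ}

theorem cocoEst_nonneg (hc : ConvexOn ℝ Set.univ F) (hd : Differentiable ℝ F)
    (u v : EuclideanSpace ℝ (Fin n)) : 0 ≤ cocoEst F u v :=
  div_nonneg (sq_nonneg _) (inner_sub_nonneg_of_convexOn_of_hasGradientAt hc (Set.mem_univ _)
    (Set.mem_univ _) (hd u).hasGradientAt (hd v).hasGradientAt)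

theorem lipEst_mul_cocoEst_mul_sq_norm (hc : ConvexOn ℝ Set.univ F) (hd : Differentiable ℝ F)
    (u v : EuclideanSpace ℝ (Fin n)) :
    lipEst F u v * cocoEst F u v * ‖u - v‖ ^ 2 = ‖∇ F u - ∇ F v‖ ^ 2 := by
  rw [mul_right_comm, lipEst_mul_sq_norm, cocoEst]
  rcases eq_or_ne (inner ℝ (∇ F u - ∇ F v) (u - v)) 0 with hinner | hinner
  · have hgrad : ∇ F u = ∇ F v := eq_of_inner_sub_eq_zero_of_hasGradientAt hc
      (hd u).hasGradientAt (hd v).hasGradientAt hinner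
    simp [hgrad]
  · field_simp

/-- The quantity `α ℓ max {α c - 1, 0}` under the root in the denominator of the second stepsize
bound of adaBiM. -/
noncomputable def excess (F : EuclideanSpace ℝ (Fin n) → ℝ) (α : ℝ)
    (u v : EuclideanSpace ℝ (Fin n)) : ℝ :=
  α * lipEst F u v * max (α * cocoEst F u v - 1) 0

theorem excess_nonneg (hc : ConvexOn ℝ Set.univ F) (hd : Differentiable ℝ F) (hα : 0 ≤ α)
    (u v : EuclideanSpace ℝ (Fin n)) : 0 ≤ excess F α u v :=
  mul_nonneg (mul_nonneg hα (lipEst_nonneg hc hd u v)) (le_max_right _ _)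

theorem sq_norm_sub_inner_le_excess_mul (hc : ConvexOn ℝ Set.univ F) (hd : Differentiable ℝ F)
    (hα : 0 ≤ α) (u v : EuclideanSpace ℝ (Fin n)) :
    α ^ 2 * ‖∇ F u - ∇ F v‖ ^ 2 - α * inner ℝ (∇ F u - ∇ F v) (u - v) ≤
      excess F α u v * ‖u - v‖ ^ 2 := by
  have hℓ := lipEst_nonneg hc hd u v
  calc α ^ 2 * ‖∇ F u - ∇ F v‖ ^ 2 - α * inner ℝ (∇ F u - ∇ F v) (u - v)
      = α * lipEst F u v * (α * cocoEst F u v - 1) * ‖u - v‖ ^ 2 := by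
        rw [← lipEst_mul_cocoEst_mul_sq_norm hc hd, ← lipEst_mul_sq_norm]
        ring
    _ ≤ excess F α u v * ‖u - v‖ ^ 2 := by
        rw [excess]
        gcongr
        exact le_max_left _ _

theorem excess_le_sq_of_norm_sub_le (hc : ConvexOn ℝ Set.univ F) (hd : Differentiable ℝ F)
    (hα : 0 ≤ α) {L : ℝ} {u v : EuclideanSpace ℝ (Fin n)}
    (h : ‖∇ F u - ∇ F v‖ ≤ L * ‖u - v‖) : excess F α u v ≤ (α * L) ^ 2 := by
  have hℓ := lipEst_nonneg hc hd u v
  have hc₀ := cocoEst_nonneg hc hd u v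
  have hprod : lipEst F u v * cocoEst F u v ≤ L ^ 2 := by
    rcases eq_or_ne u v with rfl | huv
    · simp only [lipEst, sub_self, norm_zero, inner_zero_right, zero_div, zero_mul]
      positivity
    · have hnorm : 0 < ‖u - v‖ := norm_pos_iff.2 (sub_ne_zero.2 huv)
      refine le_of_mul_le_mul_right ?_ (pow_pos hnorm 2)
      rw [lipEst_mul_cocoEst_mul_sq_norm hc hd, ← mul_pow]
      gcongr
  calc excess F α u v ≤ α * lipEst F u v * (α * cocoEst F u v) := by
        rw [excess]
        gcongr
        exact max_le (sub_le_self _ zero_le_one) (by positivity)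
    _ = α ^ 2 * (lipEst F u v * cocoEst F u v) := by ring
    _ ≤ (α * L) ^ 2 := by
        rw [mul_pow]
        gcongr

end Estimates

namespace BilevelProblem

variable {n : ℕ} {P : BilevelProblem n}

section TrialStepsize

variable {αmax σp σ σn αp α a : ℝ} {xp x : EuclideanSpace ℝ (Fin n)}

theorem gradient_f_sub (hP : P.BasicAssumption) (σ : ℝ) (u v : EuclideanSpace ℝ (Fin n)) :
    ∇ (P.f σ) u - ∇ (P.f σ) v = σ • (∇ P.f₁ u - ∇ P.f₁ v) + (∇ P.f₂ u - ∇ P.f₂ v) := by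
  rw [gradient_f hP, gradient_f hP]
  module

theorem inner_gradient_f₂_sub_le (hP : P.BasicAssumption) (hσ : 0 ≤ σ)
    (u v : EuclideanSpace ℝ (Fin n)) :
    inner ℝ (∇ P.f₂ u - ∇ P.f₂ v) (u - v) ≤ inner ℝ (∇ (P.f σ) u - ∇ (P.f σ) v) (u - v) := by
  have hd := differentiable_f₁ hP
  rw [gradient_f_sub hP, inner_add_left, real_inner_smul_left, le_add_iff_nonneg_left]
  exact mul_nonneg hσ (inner_sub_nonneg_of_convexOn_of_hasGradientAt hP.f₁_convex
    (Set.mem_univ _) (Set.mem_univ _) (hd u).hasGradientAt (hd v).hasGradientAt)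

theorem lipEst_f₂_le (hP : P.BasicAssumption) (hσ : 0 ≤ σ) (u v : EuclideanSpace ℝ (Fin n)) :
    lipEst P.f₂ u v ≤ lipEst (P.f σ) u v :=
  div_le_div_of_nonneg_right (inner_gradient_f₂_sub_le hP hσ u v) (sq_nonneg _)

/-- The radicand `1 - 4 (1 - σ_k / σ_{k-1}) α_k ℓ_k⁽²⁾` in the numerator of the second stepsize
bound of adaBiM, with the arguments named as in `trialStepsize`. -/
noncomputable def radicand (P : BilevelProblem n) (σp σ α : ℝ)
    (xp x : EuclideanSpace ℝ (Fin n)) : ℝ :=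
  1 - 4 * (1 - σ / σp) * (α * lipEst P.f₂ xp x)

theorem one_sub_le_radicand (hP : P.BasicAssumption) (hσp : 0 < σp)
    (hσ : σ ∈ Set.Icc (3 / 4 * σp) σp) (hα : 0 ≤ α) {ν : ℝ} (htest : α * lipEst (P.f σ) xp x ≤ ν) :
    1 - ν ≤ P.radicand σp σ α xp x := by
  have hσ₀ : 0 ≤ σ := le_trans (by positivity) hσ.1
  have hratio : 3 / 4 ≤ σ / σp := by rw [le_div_iff₀ hσp]; exact hσ.1
  have hℓ₂ : 0 ≤ α * lipEst P.f₂ xp x :=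
    mul_nonneg hα (lipEst_nonneg hP.f₂_convex (differentiable_f₂ hP) xp x)
  have htest₂ : α * lipEst P.f₂ xp x ≤ ν := by grw [lipEst_f₂_le hP hσ₀, htest]
  calc 1 - ν ≤ 1 - 4 * (1 - 3 / 4) * (α * lipEst P.f₂ xp x) := by linarith
    _ ≤ P.radicand σp σ α xp x := by
      rw [radicand]
      gcongr

theorem le_trialStepsize_iff (hσ : 0 < σ) (hσn : 0 < σn) (hα : 0 < α) :
    a ≤ P.trialStepsize αmax σp σ σn αp α xp x ↔
      σn * a / (σ * α) ≤ √(σ / σp * (1 + σ * α / (σp * αp))) ∧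
      σn * a / (σ * α) * (2 * √(excess (P.f σ) α xp x)) ≤ √(P.radicand σp σ α xp x) ∧
      a ≤ αmax := by
  have hscale : ∀ q, a ≤ q * (σ / σn) * α ↔ σn * a / (σ * α) ≤ q := fun q => by
    rw [div_le_iff₀ (by positivity), ← mul_div_assoc, div_mul_eq_mul_div, le_div_iff₀ hσn]
    ring_nf
  have hunfold : P.trialStepsize αmax σp σ σn αp α xp x =
      if 2 * √(excess (P.f σ) α xp x) = 0 then
        min (√(σ / σp * (1 + σ * α / (σp * αp))) * (σ / σn) * α) αmax
      else min (√(σ / σp * (1 + σ * α / (σp * αp))) * (σ / σn) * α)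
        (min (√(P.radicand σp σ α xp x) / (2 * √(excess (P.f σ) α xp x)) * (σ / σn) * α) αmax) :=
    rfl
  rw [hunfold]
  split_ifs with hden
  · simp only [hden, le_min_iff, hscale, mul_zero, Real.sqrt_nonneg, true_and]
  · have hden_pos : 0 < 2 * √(excess (P.f σ) α xp x) :=
      lt_of_le_of_ne (by positivity) (Ne.symm hden)
    simp only [le_min_iff, hscale, le_div_iff₀ hden_pos]

theorem sq_mul_excess_le_of_le_trialStepsize (hP : P.BasicAssumption) (hσ : 0 < σ) (hσn : 0 < σn)
    (hα : 0 < α) (ha : 0 ≤ a) (hr : 0 ≤ P.radicand σp σ α xp x)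
    (h : a ≤ P.trialStepsize αmax σp σ σn αp α xp x) :
    (σn * a / (σ * α)) ^ 2 * excess (P.f σ) α xp x ≤ P.radicand σp σ α xp x / 4 := by
  have hexcess :=
    excess_nonneg (convexOn_f hP hσ.le) (differentiable_f hP σ) hα.le xp x
  have hsq : (σn * a / (σ * α) * (2 * √(excess (P.f σ) α xp x))) ^ 2 ≤
      √(P.radicand σp σ α xp x) ^ 2 := by
    gcongr
    exact ((le_trialStepsize_iff hσ hσn hα).1 h).2.1
  rw [Real.sq_sqrt hr, mul_pow, mul_pow, Real.sq_sqrt hexcess] at hsq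
  linarith

theorem min_le_trialStepsize (hP : P.BasicAssumption) (hσ : 0 < σ) (hσn : 0 < σn) (hσσ : σn ≤ σ)
    (hα : 0 < α) (hmax : 0 ≤ αmax) {b L : ℝ} (hL : 0 < L) (hr : b ≤ P.radicand σp σ α xp x)
    (hlip : ‖∇ (P.f σ) xp - ∇ (P.f σ) x‖ ≤ L * ‖xp - x‖) :
    min (min (√b / (2 * L)) αmax) (√(σ / σp * (1 + σ * α / (σp * αp))) * α) ≤
      P.trialStepsize αmax σp σ σn αp α xp x := by
  set t := min (min (√b / (2 * L)) αmax) (√(σ / σp * (1 + σ * α / (σp * αp))) * α)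
  have : 0 ≤ t := by positivity
  have hquot : σn * t / (σ * α) ≤ t / α := by
    rw [mul_div_mul_comm]
    exact mul_le_of_le_one_left (by positivity) (div_le_one_of_le₀ hσσ hσ.le)
  refine (le_trialStepsize_iff hσ hσn hα).2
    ⟨hquot.trans ((div_le_iff₀ hα).2 (min_le_right _ _)), ?_,
      (min_le_left _ _).trans (min_le_right _ _)⟩
  have hexcess : √(excess (P.f σ) α xp x) ≤ α * L :=
    (Real.sqrt_le_left (by positivity)).2
      (excess_le_sq_of_norm_sub_le (convexOn_f hP hσ.le) (differentiable_f hP σ) hα.le hlip)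
  calc σn * t / (σ * α) * (2 * √(excess (P.f σ) α xp x)) ≤ t / α * (2 * (α * L)) := by gcongr
    _ = t * (2 * L) := by field_simp
    _ ≤ √b := (le_div_iff₀ (by positivity)).1 ((min_le_left _ _).trans (min_le_left _ _))
    _ ≤ √(P.radicand σp σ α xp x) := Real.sqrt_le_sqrt hr

theorem trialStepsize_pos (hP : P.BasicAssumption) (hσp : 0 < σp) (hσ : 0 < σ) (hσn : 0 < σn)
    (hσσ : σn ≤ σ) (hαp : 0 < αp) (hα : 0 < α) (hmax : 0 < αmax)
    (hr : 0 < P.radicand σp σ α xp x) : 0 < P.trialStepsize αmax σp σ σn αp α xp x := by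
  obtain ⟨L, hL, hlip⟩ := exists_norm_gradient_f_sub_le hP hσ.le (max ‖xp‖ ‖x‖)
  refine lt_of_lt_of_le ?_ (min_le_trialStepsize hP hσ hσn hσσ hα hmax.le hL le_rfl
    (hlip σ xp x hσ.le le_rfl (le_max_left _ _) (le_max_right _ _)))
  positivity

end TrialStepsize

section TwoSteps

variable {σp σ σn αp α αn αmax a : ℝ} {xp x z xs w : EuclideanSpace ℝ (Fin n)}

/-- The part of the adaBiM energy that accounts for the last displacement from `xp` to `x`, made
with stepsize `α`, while the inverse penalty dropped from `σp` to `σ`. -/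
noncomputable def displacementEnergy (P : BilevelProblem n) (σp σ α : ℝ)
    (xp x : EuclideanSpace ℝ (Fin n)) : ℝ :=
  ‖xp - x‖ ^ 2 / 4 - (α - σ * α / σp) * inner ℝ (∇ P.f₂ xp - ∇ P.f₂ x) (xp - x)

theorem displacementEnergy_eq (P : BilevelProblem n) (σp σ α : ℝ)
    (xp x : EuclideanSpace ℝ (Fin n)) :
    P.displacementEnergy σp σ α xp x = P.radicand σp σ α xp x / 4 * ‖xp - x‖ ^ 2 := by
  rw [displacementEnergy, radicand, ← lipEst_mul_sq_norm]
  ring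

theorem displacementEnergy_nonneg (hr : 0 ≤ P.radicand σp σ α xp x) :
    0 ≤ P.displacementEnergy σp σ α xp x := by
  rw [displacementEnergy_eq]
  positivity

theorem displacementEnergy_le (hP : P.BasicAssumption) (hσp : 0 < σp) (hσ : σ ≤ σp) (hα : 0 ≤ α) :
    P.displacementEnergy σp σ α xp x ≤ ‖xp - x‖ ^ 2 / 4 := by
  have hd := differentiable_f₂ hP
  refine sub_le_self _ (mul_nonneg ?_ (inner_sub_nonneg_of_convexOn_of_hasGradientAt
    hP.f₂_convex (Set.mem_univ _) (Set.mem_univ _) (hd xp).hasGradientAt (hd x).hasGradientAt))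
  rw [sub_nonneg, mul_div_right_comm]
  exact mul_le_of_le_one_left hα (div_le_one_of_le₀ hσ hσp.le)

theorem mul_val_sub_model_le (hP : P.BasicAssumption) (hσ : 0 < σ) (hσn : 0 < σn)
    (haσ : a * σ = αn * σn) (ha : a ≤ αn) (hxs : xs ∈ P.X₁) (hz : z ∈ P.dom) :
    αn * (P.val σn xs -
        (P.f σn x + inner ℝ (∇ (P.f σn) x) (z - x) + (P.g σn z).toReal)) ≤
      a * (P.val σ xs - (P.f σ x + inner ℝ (∇ (P.f σ) x) (z - x) + (P.g σ z).toReal)) +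
        (αn - a) * inner ℝ (∇ P.f₂ x - ∇ P.f₂ z) (x - z) := by
  have hconvex : P.f₂ z + inner ℝ (∇ P.f₂ z) (x - z) ≤ P.f₂ x :=
    add_inner_le_of_convexOn_of_hasGradientAt hP.f₂_convex (Set.mem_univ z) (Set.mem_univ x)
      (differentiable_f₂ hP z).hasGradientAt
  have hlower : P.val₂ xs - (P.f₂ x + inner ℝ (∇ P.f₂ x) (z - x) + (P.g₂ z).toReal) ≤
      inner ℝ (∇ P.f₂ x - ∇ P.f₂ z) (x - z) := by
    have hopt := val₂_le_of_mem_X₁ hP hxs hz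
    rw [val₂, val₂] at hopt
    rw [val₂, inner_sub_left, ← neg_sub x z, inner_neg_right]
    linarith
  have hscaled := mul_le_mul_of_nonneg_left hlower (sub_nonneg.2 ha)
  have hsplit : αn * (P.val σn xs -
        (P.f σn x + inner ℝ (∇ (P.f σn) x) (z - x) + (P.g σn z).toReal)) =
      a * (P.val σ xs - (P.f σ x + inner ℝ (∇ (P.f σ) x) (z - x) + (P.g σ z).toReal)) +
        (αn - a) * (P.val₂ xs - (P.f₂ x + inner ℝ (∇ P.f₂ x) (z - x) + (P.g₂ z).toReal)) := by
    simp only [toReal_g hP hσ hz, toReal_g hP hσn hz, gradient_f hP, val, f, inner_add_left,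
      real_inner_smul_left]
    linear_combination (-(P.val₁ xs - (P.f₁ x + inner ℝ (∇ P.f₁ x) (z - x) +
      (P.g₁ z).toReal))) * haσ
  linarith

theorem IsProxGradStep.mul_sub_inner_le (h : P.IsProxGradStep σ α xp x) (hP : P.BasicAssumption)
    (hσ : 0 < σ) (hα : 0 < α) (hw : w ∈ P.dom) :
    α * ((P.g σ x).toReal - (P.g σ w).toReal - inner ℝ (∇ (P.f σ) x) (w - x)) ≤
      inner ℝ (xp - x - α • (∇ (P.f σ) xp - ∇ (P.f σ) x)) (x - w) := by
  have hstep := h.inner_le hP hσ hα hw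
  rw [inner_sub_left, real_inner_smul_left, inner_sub_left (∇ (P.f σ) xp), ← neg_sub w x]
  simp only [inner_neg_right]
  linarith

theorem IsProxGradStep.sq_norm_sub_smul_gradient_sub_le (h : P.IsProxGradStep σ α xp x)
    (hP : P.BasicAssumption) (hσ : 0 < σ) (hα : 0 < α) (hxp : xp ∈ P.dom) :
    ‖xp - x - α • (∇ (P.f σ) xp - ∇ (P.f σ) x)‖ ^ 2 ≤
      excess (P.f σ) α xp x * ‖xp - x‖ ^ 2 + α * (P.val σ xp - P.val σ x) := by
  have hdecrease := h.sq_sub_inner_le hP hσ hα hxp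
  have hexcess := sq_norm_sub_inner_le_excess_mul (convexOn_f hP hσ.le) (differentiable_f hP σ)
    hα.le xp x
  rw [norm_sub_sq_real, real_inner_smul_right, norm_smul, mul_pow, Real.norm_of_nonneg hα.le,
    real_inner_comm]
  linarith

theorem IsProxGradStep.energy_le (h : P.IsProxGradStep σ α xp x)
    (hn : P.IsProxGradStep σn αn x z) (hP : P.BasicAssumption) (hσ : 0 < σ) (hσn : 0 < σn)
    (hσσ : σn ≤ σ) (hα : 0 < α) (hαn : 0 < αn) (hr : 0 ≤ P.radicand σp σ α xp x)
    (htrial : αn ≤ P.trialStepsize αmax σp σ σn αp α xp x) (hxp : xp ∈ P.dom)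
    (hxs : xs ∈ P.X₁) :
    ‖z - xs‖ ^ 2 / 2 + P.displacementEnergy σ σn αn x z +
        σn * αn / σ * (P.val σ x - P.val σ xs) ≤
      ‖x - xs‖ ^ 2 / 2 + P.displacementEnergy σp σ α xp x +
        σn * αn / σ * (σn * αn / (σ * α)) * (P.val σ xp - P.val σ x) := by
  set a := σn * αn / σ with ha
  set ρ := σn * αn / (σ * α) with hρ
  have haρ : ρ * α = a := by rw [hρ, ha]; field_simp
  have ha_le : a ≤ αn := (div_le_iff₀ hσ).2 (by nlinarith)
  have hx := h.mem_dom hP hσ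
  have hz := hn.mem_dom hP hσn
  set H := xp - x - α • (∇ (P.f σ) xp - ∇ (P.f σ) x)
  have hthree := hn.half_sq_add_half_sq_le hP hσn hαn (mem_dom_of_mem_X₁ hxs)
  have hmodel := mul_val_sub_model_le (x := x) hP hσ hσn
    (by rw [ha, div_mul_cancel₀ _ hσ.ne', mul_comm] : a * σ = αn * σn) ha_le hxs hz
  have hcross : a * ((P.g σ x).toReal - (P.g σ z).toReal - inner ℝ (∇ (P.f σ) x) (z - x)) ≤
      ρ * inner ℝ H (x - z) := by
    rw [← haρ, mul_assoc]
    exact mul_le_mul_of_nonneg_left (h.mul_sub_inner_le hP hσ hα hz) (by positivity)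
  have hyoung : ρ * inner ℝ H (x - z) ≤ ‖x - z‖ ^ 2 / 4 + ρ ^ 2 * ‖H‖ ^ 2 := by
    have hcs : ρ * inner ℝ H (x - z) ≤ ρ * (‖H‖ * ‖x - z‖) :=
      mul_le_mul_of_nonneg_left (real_inner_le_norm _ _) (by positivity)
    linarith [sq_nonneg (‖x - z‖ / 2 - ρ * ‖H‖)]
  have hH : ρ ^ 2 * ‖H‖ ^ 2 ≤ P.displacementEnergy σp σ α xp x +
      a * ρ * (P.val σ xp - P.val σ x) := by
    have hexcess := sq_mul_excess_le_of_le_trialStepsize hP hσ hσn hα hαn.le hr htrial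
    grw [h.sq_norm_sub_smul_gradient_sub_le hP hσ hα hxp, displacementEnergy_eq, ← hexcess]
    rw [← haρ]
    exact le_of_eq (by ring)
  have hval : a * P.val σ x = a * (P.f σ x + (P.g σ x).toReal) := by rw [val_eq hP hσ hx]
  have hlast : P.displacementEnergy σ σn αn x z =
      ‖x - z‖ ^ 2 / 4 - (αn - a) * inner ℝ (∇ P.f₂ x - ∇ P.f₂ z) (x - z) := rfl
  rw [norm_sub_rev z x] at hthree
  rw [hlast]
  linarith

end TwoSteps

end BilevelProblem

theorem exists_seq_of_forall_exists_succ {S : Type*} (I : ℕ → S → Prop) (r : ℕ → S → S → Prop)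
    {s₀ : S} (hs₀ : I 0 s₀) (hstep : ∀ k s, I k s → ∃ t, I (k + 1) t ∧ r k s t) :
    ∃ u : ℕ → S, u 0 = s₀ ∧ ∀ k, r k (u k) (u (k + 1)) := by
  choose! T hT hr using hstep
  let u : ℕ → S := fun k => Nat.rec s₀ T k
  have hI : ∀ k, I k (u k) := by
    intro k
    induction k with
    | zero => exact hs₀
    | succ k ih => exact hT k _ ih
  exact ⟨u, rfl, fun k => hr k _ (hI k)⟩

section Backtracking

variable {Q : ℝ → Prop} {t η b : ℝ}

theorem exists_isGreatest_backtracking (ht : 0 < t) (hη : η ∈ Set.Ioo (0 : ℝ) 1) (hb : 0 < b)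
    (hQ : ∀ a, 0 < a → a ≤ b → Q a) :
    ∃ a, IsGreatest {a : ℝ | (∃ i : ℕ, a = t * η ^ i) ∧ Q a} a := by
  classical
  have hex : ∃ i : ℕ, Q (t * η ^ i) := by
    obtain ⟨i, hi⟩ := exists_pow_lt_of_lt_one (div_pos hb ht) hη.2
    exact ⟨i, hQ _ (mul_pos ht (pow_pos hη.1 i)) ((lt_div_iff₀' ht).1 hi).le⟩
  refine ⟨t * η ^ Nat.find hex, ⟨⟨_, rfl⟩, Nat.find_spec hex⟩, ?_⟩
  rintro _ ⟨⟨j, rfl⟩, hj⟩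
  have hpow := pow_le_pow_of_le_one hη.1.le hη.2.le (Nat.find_min' hex hj)
  gcongr

theorem min_le_of_isGreatest_backtracking {a : ℝ} (ht : 0 < t) (hη : η ∈ Set.Ioo (0 : ℝ) 1)
    (hQ : ∀ a, 0 < a → a ≤ b → Q a)
    (ha : IsGreatest {a : ℝ | (∃ i : ℕ, a = t * η ^ i) ∧ Q a} a) : min t (η * b) ≤ a := by
  obtain ⟨⟨⟨i, hi⟩, -⟩, hgreatest⟩ := ha
  cases i with
  | zero => simp [hi]
  | succ i =>
    have hprev : 0 < t * η ^ i := mul_pos ht (pow_pos hη.1 i)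
    have ha_eq : a = η * (t * η ^ i) := by rw [hi]; ring
    have hrejected : b < t * η ^ i := by
      by_contra! hle
      have hle_a : t * η ^ i ≤ a := hgreatest ⟨⟨i, rfl⟩, hQ _ hprev hle⟩
      exact (mul_lt_of_lt_one_left hprev hη.2).not_ge (ha_eq ▸ hle_a)
    rw [ha_eq]
    exact (min_le_right _ _).trans (mul_le_mul_of_nonneg_left hrejected.le hη.1.le)

end Backtracking

section RatioGrowth

variable {r ρ α : ℕ → ℝ}

theorem le_max_two_of_succ_le_sqrt (hr : ∀ k, r k ≤ 1) (hρ : ∀ k, 0 ≤ ρ k)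
    (hgrowth : ∀ k, ρ (k + 1) ≤ √(r k * (1 + ρ k))) (k : ℕ) : ρ k ≤ max 2 (ρ 0) := by
  induction k with
  | zero => exact le_max_right _ _
  | succ k ih =>
    set R := max 2 (ρ 0)
    have hR : 2 ≤ R := le_max_left _ _
    refine (hgrowth k).trans ((Real.sqrt_le_left (by linarith)).2 ?_)
    calc r k * (1 + ρ k) ≤ 1 + ρ k := mul_le_of_le_one_left (by linarith [hρ k]) (hr k)
      _ ≤ 1 + R := by gcongr
      _ ≤ R ^ 2 := by nlinarith

theorem mul_min_le_of_min_sqrt_mul_le {c : ℝ} (hα : ∀ k, 0 < α k) (hr : ∀ k, 3 / 4 ≤ r k)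
    (hρ₀ : ∀ k, 0 ≤ ρ k) (hρ : ∀ k, ρ (k + 1) = r (k + 1) * α (k + 1) / α k) (hc : 0 ≤ c)
    (hgrowth : ∀ k, min c (√(r k * (1 + ρ k)) * α k) ≤ α (k + 1)) (k : ℕ) :
    3 / 4 * min (α 0) c ≤ α k := by
  have hm : 0 ≤ min (α 0) c := le_min (hα 0).le hc
  have hmc : min (α 0) c ≤ c := min_le_right _ _
  -- Only the step right after a value above the threshold can shrink: it leaves `1 / 3 ≤ ρ`, which
  -- makes the next growth factor at least `1`.
  suffices h : 3 / 4 * min (α 0) c ≤ α k ∧ (min (α 0) c ≤ α k ∨ 1 / 3 ≤ ρ k) from h.1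
  induction k with
  | zero => exact ⟨by linarith [min_le_left (α 0) c], Or.inl (min_le_left _ _)⟩
  | succ k ih =>
    have hfactor : 3 / 4 ≤ √(r k * (1 + ρ k)) :=
      Real.le_sqrt_of_sq_le (by nlinarith [hr k, hρ₀ k])
    have hfactor_one (hk : 1 / 3 ≤ ρ k) : 1 ≤ √(r k * (1 + ρ k)) :=
      Real.le_sqrt_of_sq_le (by nlinarith [hr k])
    rcases min_le_iff.1 (hgrowth k) with hck | hgrow
    · exact ⟨by linarith, Or.inl (hmc.trans hck)⟩
    · have hshrink : 3 / 4 * α k ≤ α (k + 1) :=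
        (mul_le_mul_of_nonneg_right hfactor (hα k).le).trans hgrow
      refine ⟨?_, Or.inr ?_⟩
      · rcases ih.2 with hmk | hk
        · linarith
        · linarith [mul_le_mul_of_nonneg_right (hfactor_one hk) (hα k).le, ih.1]
      · rw [hρ, le_div_iff₀ (hα k)]
        nlinarith [hr (k + 1), hα k, hα (k + 1)]

end RatioGrowth

namespace IsSlowlyDecreasing

variable {σ : ℕ → ℝ}

theorem prev_pos (h : IsSlowlyDecreasing σ) (k : ℕ) : 0 < prev (σ 0) σ k := by
  cases k with
  | zero => exact h.zero_pos
  | succ k => exact h.pos k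

theorem mem_Icc_prev (h : IsSlowlyDecreasing σ) (k : ℕ) :
    σ k ∈ Set.Icc (3 / 4 * prev (σ 0) σ k) (prev (σ 0) σ k) := by
  cases k with
  | zero => exact ⟨mul_le_of_le_one_left h.zero_pos.le (by norm_num), le_rfl⟩
  | succ k => exact h.mem_Icc k

end IsSlowlyDecreasing

namespace BilevelProblem

variable {n : ℕ} {P : BilevelProblem n}

theorem exists_forall_le_exists_isProxGradStep (hP : P.BasicAssumption) {s ν : ℝ} (hs : 0 ≤ s)
    (hν : 0 < ν) (K : ℝ) :
    ∃ b, 0 < b ∧ ∀ σ a x, 0 < σ → σ ≤ s → ‖x‖ ≤ K → 0 < a → a ≤ b →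
      ∃ z, P.IsProxGradStep σ a x z ∧ a * lipEst (P.f σ) x z ≤ ν := by
  obtain ⟨L, hL, hlip⟩ := exists_lipEst_le_of_isProxGradStep hP hs 1 K
  refine ⟨min (ν / L) 1, by positivity, fun σ a x hσ hσs hx ha hab => ?_⟩
  obtain ⟨z, hz⟩ := exists_isProxGradStep hP hσ ha x
  refine ⟨z, hz, ?_⟩
  calc a * lipEst (P.f σ) x z ≤ ν / L * L := by
        grw [hlip σ a x z hσ hσs ha (hab.trans (min_le_right _ _)) hx hz,
          hab.trans (min_le_left _ _)]
    _ = ν := div_mul_cancel₀ ν hL.ne'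

theorem radicand_self {σ : ℝ} (hσ : σ ≠ 0) (α : ℝ) (xp x : EuclideanSpace ℝ (Fin n)) :
    P.radicand σ σ α xp x = 1 := by
  simp [radicand, hσ]

theorem exists_isGreatest_linesearch (hP : P.BasicAssumption)
    {η ν αmax σp σ σn αp α : ℝ} {xp x : EuclideanSpace ℝ (Fin n)} (hη : η ∈ Set.Ioo (0 : ℝ) 1)
    (hν : ν ∈ Set.Ioo (0 : ℝ) 1) (hmax : 0 < αmax) (hσp : 0 < σp) (hσ : 0 < σ)
    (hσn : σn ∈ Set.Icc (3 / 4 * σ) σ) (hαp : 0 < αp) (hα : 0 < α)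
    (hr : 1 - ν ≤ P.radicand σp σ α xp x) :
    ∃ a z, 0 < a ∧ P.IsProxGradStep σn a x z ∧ 1 - ν ≤ P.radicand σ σn a x z ∧
      IsGreatest {a : ℝ | (∃ i : ℕ, a = P.trialStepsize αmax σp σ σn αp α xp x * η ^ i) ∧
        ∃ z, P.IsProxGradStep σn a x z ∧ a * lipEst (P.f σn) x z ≤ ν} a := by
  have hσn_pos : 0 < σn := lt_of_lt_of_le (by positivity) hσn.1
  have ht := trialStepsize_pos hP hσp hσ hσn_pos hσn.2 hαp hα hmax ((sub_pos.2 hν.2).trans_le hr)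
  obtain ⟨b, hb, hsmall⟩ := exists_forall_le_exists_isProxGradStep hP hσn_pos.le hν.1 ‖x‖
  obtain ⟨a, ha⟩ := exists_isGreatest_backtracking ht hη hb
    fun a => hsmall σn a x hσn_pos le_rfl le_rfl
  obtain ⟨⟨i, hi⟩, z, hz, htest⟩ := ha.1
  have ha_pos : 0 < a := hi ▸ mul_pos ht (pow_pos hη.1 i)
  exact ⟨a, z, ha_pos, hz, one_sub_le_radicand hP hσ hσn ha_pos.le htest, ha⟩

theorem exists_isAdaBiM (hP : P.BasicAssumption) {σ : ℕ → ℝ} (hσ : IsSlowlyDecreasing σ)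
    {η ν αmax αinit α₀ : ℝ} (hν : ν ∈ Set.Ioo (0 : ℝ) 1) (hη : η ∈ Set.Ioo (0 : ℝ) 1)
    (hmax : 0 < αmax) (hinit : 0 < αinit) (hα₀ : 0 < α₀) (xinit : EuclideanSpace ℝ (Fin n)) :
    ∃ x α, P.IsAdaBiM η ν αmax σ xinit αinit α₀ x α := by
  let E := EuclideanSpace ℝ (Fin n)
  obtain ⟨x₀, hx₀⟩ := exists_isProxGradStep hP hσ.zero_pos hα₀ xinit
  -- A state `((x_{k-1}, x_k), (α_{k-1}, α_k))` determines the next linesearch.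
  obtain ⟨u, hu₀, hu⟩ := exists_seq_of_forall_exists_succ (S := (E × E) × (ℝ × ℝ))
    (fun k s => 0 < s.2.1 ∧ 0 < s.2.2 ∧
      1 - ν ≤ P.radicand (prev (σ 0) σ k) (σ k) s.2.2 s.1.1 s.1.2)
    (fun k s t => t.1.1 = s.1.2 ∧ t.2.1 = s.2.2 ∧
      IsGreatest {a : ℝ | (∃ i : ℕ, a = P.trialStepsize αmax (prev (σ 0) σ k) (σ k) (σ (k + 1))
          s.2.1 s.2.2 s.1.1 s.1.2 * η ^ i) ∧
        ∃ z, P.IsProxGradStep (σ (k + 1)) a s.1.2 z ∧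
          a * lipEst (P.f (σ (k + 1))) s.1.2 z ≤ ν} t.2.2 ∧
      P.IsProxGradStep (σ (k + 1)) t.2.2 s.1.2 t.1.2)
    (s₀ := ((xinit, x₀), (αinit, α₀)))
    ⟨hinit, hα₀, (sub_le_self 1 hν.1.le).trans_eq
      (radicand_self hσ.zero_pos.ne' α₀ xinit x₀).symm⟩
    (by
      rintro k ⟨⟨xp, x⟩, ⟨αp, α⟩⟩ ⟨hαp, hα, hr⟩
      obtain ⟨a, z, ha, hz, hr', hgreatest⟩ := exists_isGreatest_linesearch hP hη hν hmax
        (hσ.prev_pos k) (hσ.pos k) (hσ.mem_Icc k) hαp hα hr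
      exact ⟨((x, z), (α, a)), ⟨hα, ha, hr'⟩, rfl, rfl, hgreatest, hz⟩)
  have hprev_x : ∀ k, prev xinit (fun k => (u k).1.2) k = (u k).1.1 := by
    rintro (_ | k)
    exacts [by rw [hu₀]; rfl, (hu k).1.symm]
  have hprev_α : ∀ k, prev αinit (fun k => (u k).2.2) k = (u k).2.1 := by
    rintro (_ | k)
    exacts [by rw [hu₀]; rfl, (hu k).2.1.symm]
  refine ⟨fun k => (u k).1.2, fun k => (u k).2.2, by rw [hu₀], by simpa only [hu₀] using hx₀,
    fun k => ?_, fun k => (hu k).2.2.2⟩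
  rw [hprev_x, hprev_α]
  exact (hu k).2.2.1

/-- A run of adaBiM together with the standing assumptions on its data under which it is
analysed. -/
structure IsAdaBiMRun (P : BilevelProblem n) (η ν αmax : ℝ) (σ : ℕ → ℝ)
    (xinit : EuclideanSpace ℝ (Fin n)) (αinit α₀ : ℝ) (x : ℕ → EuclideanSpace ℝ (Fin n))
    (α : ℕ → ℝ) : Prop where
  isAdaBiM : P.IsAdaBiM η ν αmax σ xinit αinit α₀ x α
  basicAssumption : P.BasicAssumption
  slow : IsSlowlyDecreasing σ
  ν_mem : ν ∈ Set.Ioo (0 : ℝ) 1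
  η_mem : η ∈ Set.Ioo (0 : ℝ) 1
  αmax_pos : 0 < αmax
  αinit_pos : 0 < αinit
  α₀_pos : 0 < α₀

/-- The ratio `ρ_k = σ_k α_k / (σ_{k-1} α_{k-1})` of consecutive scaled stepsizes. -/
noncomputable def scaledRatio (σ α : ℕ → ℝ) (αinit : ℝ) (k : ℕ) : ℝ :=
  σ k * α k / (prev (σ 0) σ k * prev αinit α k)

namespace IsAdaBiMRun

variable {η ν αmax αinit α₀ : ℝ} {σ : ℕ → ℝ} {xinit : EuclideanSpace ℝ (Fin n)}
  {x : ℕ → EuclideanSpace ℝ (Fin n)} {α : ℕ → ℝ}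

section Stepsizes

theorem mem_dom (h : P.IsAdaBiMRun η ν αmax σ xinit αinit α₀ x α) (k : ℕ) : x k ∈ P.dom := by
  cases k with
  | zero => exact h.isAdaBiM.x_zero.mem_dom h.basicAssumption h.slow.zero_pos
  | succ k => exact (h.isAdaBiM.x_succ k).mem_dom h.basicAssumption (h.slow.pos _)

theorem mul_lipEst_le (h : P.IsAdaBiMRun η ν αmax σ xinit αinit α₀ x α) {k : ℕ}
    (hα : 0 < α (k + 1)) :
    α (k + 1) * lipEst (P.f (σ (k + 1))) (x k) (x (k + 1)) ≤ ν := by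
  obtain ⟨-, z, hz, htest⟩ := (h.isAdaBiM.α_succ k).1
  rwa [(h.isAdaBiM.x_succ k).unique h.basicAssumption (h.slow.pos _) hα hz]

theorem stepsize_pos_and_one_sub_le_radicand
    (h : P.IsAdaBiMRun η ν αmax σ xinit αinit α₀ x α) (k : ℕ) :
    0 < prev αinit α k ∧ 0 < α k ∧
      1 - ν ≤ P.radicand (prev (σ 0) σ k) (σ k) (α k) (prev xinit x k) (x k) := by
  induction k with
  | zero =>
    refine ⟨h.αinit_pos, h.isAdaBiM.α_zero ▸ h.α₀_pos, ?_⟩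
    exact (sub_le_self 1 h.ν_mem.1.le).trans_eq (radicand_self h.slow.zero_pos.ne' _ _ _).symm
  | succ k ih =>
    obtain ⟨hαp, hα, hr⟩ := ih
    obtain ⟨⟨i, hi⟩, -⟩ := (h.isAdaBiM.α_succ k).1
    have htrial := trialStepsize_pos h.basicAssumption (h.slow.prev_pos k) (h.slow.pos k)
      (h.slow.pos (k + 1)) (h.slow.mem_Icc k).2 hαp hα h.αmax_pos
      ((sub_pos.2 h.ν_mem.2).trans_le hr)
    have hα_succ : 0 < α (k + 1) := hi ▸ mul_pos htrial (pow_pos h.η_mem.1 i)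
    exact ⟨hα, hα_succ, BilevelProblem.one_sub_le_radicand h.basicAssumption (h.slow.pos k)
      (h.slow.mem_Icc k) hα_succ.le (h.mul_lipEst_le hα_succ)⟩

theorem prev_stepsize_pos (h : P.IsAdaBiMRun η ν αmax σ xinit αinit α₀ x α) (k : ℕ) :
    0 < prev αinit α k :=
  (h.stepsize_pos_and_one_sub_le_radicand k).1

theorem stepsize_pos (h : P.IsAdaBiMRun η ν αmax σ xinit αinit α₀ x α) (k : ℕ) : 0 < α k :=
  (h.stepsize_pos_and_one_sub_le_radicand k).2.1

theorem one_sub_le_radicand (h : P.IsAdaBiMRun η ν αmax σ xinit αinit α₀ x α) (k : ℕ) :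
    1 - ν ≤ P.radicand (prev (σ 0) σ k) (σ k) (α k) (prev xinit x k) (x k) :=
  (h.stepsize_pos_and_one_sub_le_radicand k).2.2

theorem radicand_pos (h : P.IsAdaBiMRun η ν αmax σ xinit αinit α₀ x α) (k : ℕ) :
    0 < P.radicand (prev (σ 0) σ k) (σ k) (α k) (prev xinit x k) (x k) :=
  (sub_pos.2 h.ν_mem.2).trans_le (h.one_sub_le_radicand k)

theorem trialStepsize_pos (h : P.IsAdaBiMRun η ν αmax σ xinit αinit α₀ x α) (k : ℕ) :
    0 < P.trialStepsize αmax (prev (σ 0) σ k) (σ k) (σ (k + 1)) (prev αinit α k) (α k)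
      (prev xinit x k) (x k) :=
  BilevelProblem.trialStepsize_pos h.basicAssumption (h.slow.prev_pos k) (h.slow.pos k)
    (h.slow.pos _) (h.slow.mem_Icc k).2 (h.prev_stepsize_pos k) (h.stepsize_pos k) h.αmax_pos
    (h.radicand_pos k)

theorem stepsize_succ_le_trialStepsize (h : P.IsAdaBiMRun η ν αmax σ xinit αinit α₀ x α)
    (k : ℕ) :
    α (k + 1) ≤ P.trialStepsize αmax (prev (σ 0) σ k) (σ k) (σ (k + 1)) (prev αinit α k) (α k)
      (prev xinit x k) (x k) := by
  obtain ⟨⟨i, hi⟩, -⟩ := (h.isAdaBiM.α_succ k).1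
  rw [hi]
  exact mul_le_of_le_one_right (h.trialStepsize_pos k).le
    (pow_le_one₀ h.η_mem.1.le h.η_mem.2.le)

theorem stepsize_succ_le_max (h : P.IsAdaBiMRun η ν αmax σ xinit αinit α₀ x α) (k : ℕ) :
    α (k + 1) ≤ αmax :=
  ((le_trialStepsize_iff (h.slow.pos k) (h.slow.pos _) (h.stepsize_pos k)).1
    (h.stepsize_succ_le_trialStepsize k)).2.2

theorem scaledRatio_nonneg (h : P.IsAdaBiMRun η ν αmax σ xinit αinit α₀ x α) (k : ℕ) :
    0 ≤ scaledRatio σ α αinit k :=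
  div_nonneg (mul_nonneg (h.slow.pos k).le (h.stepsize_pos k).le)
    (mul_nonneg (h.slow.prev_pos k).le (h.prev_stepsize_pos k).le)

theorem scaledRatio_le (h : P.IsAdaBiMRun η ν αmax σ xinit αinit α₀ x α) (k : ℕ) :
    scaledRatio σ α αinit k ≤ max 2 (α₀ / αinit) := by
  have hzero : scaledRatio σ α αinit 0 = α₀ / αinit := by
    rw [scaledRatio, h.isAdaBiM.α_zero]
    exact mul_div_mul_left _ _ h.slow.zero_pos.ne'
  rw [← hzero]
  exact le_max_two_of_succ_le_sqrt
    (fun k => (div_le_one (h.slow.prev_pos k)).2 (h.slow.mem_Icc_prev k).2) h.scaledRatio_nonneg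
    (fun k => ((le_trialStepsize_iff (h.slow.pos k) (h.slow.pos _) (h.stepsize_pos k)).1
      (h.stepsize_succ_le_trialStepsize k)).1) k

theorem exists_min_le_stepsize_succ (h : P.IsAdaBiMRun η ν αmax σ xinit αinit α₀ x α) {K : ℝ}
    (hK : ∀ k, ‖x k‖ ≤ K) :
    ∃ c : ℝ, 0 < c ∧ ∀ k,
      min c (√(σ k / prev (σ 0) σ k * (1 + scaledRatio σ α αinit k)) * α k) ≤ α (k + 1) := by
  obtain ⟨b, hb, hsmall⟩ := exists_forall_le_exists_isProxGradStep h.basicAssumption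
    h.slow.zero_pos.le h.ν_mem.1 K
  obtain ⟨L, hL, hlip⟩ := exists_norm_gradient_f_sub_le h.basicAssumption h.slow.zero_pos.le
    (max ‖xinit‖ K)
  have hprev : ∀ k, ‖prev xinit x k‖ ≤ max ‖xinit‖ K := by
    rintro (_ | k)
    exacts [le_max_left _ _, (hK k).trans (le_max_right _ _)]
  have hσ_le := fun k => h.slow.antitone (Nat.zero_le k)
  refine ⟨min (min (√(1 - ν) / (2 * L)) αmax) (η * b), ?_, fun k => ?_⟩
  · have := sub_pos.2 h.ν_mem.2
    have := h.αmax_pos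
    have := h.η_mem.1
    positivity
  have htrial := min_le_trialStepsize (σp := prev (σ 0) σ k) (αp := prev αinit α k)
    h.basicAssumption (h.slow.pos k) (h.slow.pos (k + 1)) (h.slow.mem_Icc k).2 (h.stepsize_pos k)
    h.αmax_pos.le hL (h.one_sub_le_radicand k) (hlip (σ k) (prev xinit x k) (x k)
      (h.slow.pos k).le (hσ_le k) (hprev k) ((hK k).trans (le_max_right _ _)))
  have hlinesearch := min_le_of_isGreatest_backtracking (h.trialStepsize_pos k) h.η_mem
    (fun a => hsmall (σ (k + 1)) a (x k) (h.slow.pos _) (hσ_le _) (hK k)) (h.isAdaBiM.α_succ k)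
  refine le_trans (le_min (le_trans ?_ htrial) ?_) hlinesearch
  · exact min_le_min_right _ (min_le_left _ _)
  · exact (min_le_left _ _).trans (min_le_right _ _)

theorem exists_le_stepsize (h : P.IsAdaBiMRun η ν αmax σ xinit αinit α₀ x α) {K : ℝ}
    (hK : ∀ k, ‖x k‖ ≤ K) : ∃ c : ℝ, 0 < c ∧ ∀ k, c ≤ α k := by
  obtain ⟨c, hc, hgrowth⟩ := h.exists_min_le_stepsize_succ hK
  refine ⟨3 / 4 * min (α 0) c, by have := h.stepsize_pos 0; positivity,
    mul_min_le_of_min_sqrt_mul_le h.stepsize_pos ?_ h.scaledRatio_nonneg ?_ hc.le hgrowth⟩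
  · exact fun k => (le_div_iff₀ (h.slow.prev_pos k)).2 (h.slow.mem_Icc_prev k).1
  · exact fun k => (mul_div_mul_comm _ _ _ _).trans (mul_div_assoc _ _ _).symm

end Stepsizes

end IsAdaBiMRun

/-- The weight of the penalized gap in the energy of adaBiM, which absorbs the factor
`α_k σ_k / σ_{k-1} · ρ_k` in front of the last decrease of `φ_σ`. -/
noncomputable def gapWeight (αmax αinit α₀ : ℝ) : ℝ :=
  αmax * max 2 (α₀ / αinit)

/-- The energy of adaBiM relative to `w` after step `k + 1`: half the squared distance to `w`,
corrected by the last displacement and by the penalized gap before the step. -/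
noncomputable def adaBiMEnergy (P : BilevelProblem n) (C m : ℝ) (xs : EuclideanSpace ℝ (Fin n))
    (σ α : ℕ → ℝ) (x : ℕ → EuclideanSpace ℝ (Fin n)) (k : ℕ) (w : EuclideanSpace ℝ (Fin n)) :
    ℝ :=
  ‖x (k + 1) - w‖ ^ 2 / 2
    + P.displacementEnergy (σ k) (σ (k + 1)) (α (k + 1)) (x k) (x (k + 1))
    + C * P.gap m xs (σ k) (x k)

/-- How much a step of adaBiM can move the energy, in terms of the penalized gap `t` before it, when
`B t` bounds the squared length of the step and `C` is the weight of the gap. -/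
noncomputable def energySlack (B C t : ℝ) : ℝ :=
  √(B * t) + (B * t / 4 + C * t)

section EnergySlack

variable {B C s t : ℝ}

theorem energySlack_nonneg (hB : 0 ≤ B) (hC : 0 ≤ C) (ht : 0 ≤ t) : 0 ≤ energySlack B C t := by
  unfold energySlack
  positivity

theorem energySlack_mono (hB : 0 ≤ B) (hC : 0 ≤ C) (hst : s ≤ t) :
    energySlack B C s ≤ energySlack B C t := by
  unfold energySlack
  gcongr

theorem tendsto_energySlack {u : ℕ → ℝ} (hu : Tendsto u atTop (𝓝 0)) :
    Tendsto (fun k => energySlack B C (u k)) atTop (𝓝 0) := by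
  have hcont : Continuous (energySlack B C) := by
    unfold energySlack
    fun_prop
  have hzero : energySlack B C 0 = 0 := by simp [energySlack]
  exact hzero ▸ (hcont.tendsto 0).comp hu

end EnergySlack

namespace IsAdaBiMRun

variable {η ν αmax αinit α₀ m : ℝ} {σ : ℕ → ℝ} {xinit xs : EuclideanSpace ℝ (Fin n)}
  {x : ℕ → EuclideanSpace ℝ (Fin n)} {α : ℕ → ℝ}

section Convergence

theorem gapWeight_nonneg (h : P.IsAdaBiMRun η ν αmax σ xinit αinit α₀ x α) :
    0 ≤ gapWeight αmax αinit α₀ :=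
  mul_nonneg h.αmax_pos.le (le_max_of_le_left zero_le_two)

theorem gap_nonneg (h : P.IsAdaBiMRun η ν αmax σ xinit αinit α₀ x α)
    (hm : ∀ x ∈ P.dom, m ≤ P.val₁ x) (hxs : xs ∈ P.X₁) (k : ℕ) :
    0 ≤ P.gap m xs (σ k) (x k) :=
  BilevelProblem.gap_nonneg h.basicAssumption hm hxs (h.mem_dom k) (h.slow.pos k).le

theorem val_succ_le (h : P.IsAdaBiMRun η ν αmax σ xinit αinit α₀ x α) (k : ℕ) :
    P.val (σ (k + 1)) (x (k + 1)) ≤ P.val (σ (k + 1)) (x k) :=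
  (h.isAdaBiM.x_succ k).val_le h.basicAssumption (h.slow.pos _) (h.stepsize_pos _) (h.mem_dom k)
    ((h.mul_lipEst_le (h.stepsize_pos _)).trans h.ν_mem.2.le)

theorem val_sub_succ_le_gap_sub (h : P.IsAdaBiMRun η ν αmax σ xinit αinit α₀ x α)
    (hm : ∀ x ∈ P.dom, m ≤ P.val₁ x) (k : ℕ) :
    P.val (σ (k + 1)) (x k) - P.val (σ (k + 1)) (x (k + 1)) ≤
      P.gap m xs (σ k) (x k) - P.gap m xs (σ (k + 1)) (x (k + 1)) :=
  val_sub_le_gap_sub hm (h.mem_dom k) (h.slow.mem_Icc k).2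

theorem antitone_gap (h : P.IsAdaBiMRun η ν αmax σ xinit αinit α₀ x α)
    (hm : ∀ x ∈ P.dom, m ≤ P.val₁ x) : Antitone fun k => P.gap m xs (σ k) (x k) :=
  antitone_nat_of_succ_le fun k => by
    linarith [h.val_succ_le k, h.val_sub_succ_le_gap_sub (xs := xs) hm k]

theorem sq_norm_sub_succ_le (h : P.IsAdaBiMRun η ν αmax σ xinit αinit α₀ x α)
    (hm : ∀ x ∈ P.dom, m ≤ P.val₁ x) (hxs : xs ∈ P.X₁) (k : ℕ) :
    ‖x k - x (k + 1)‖ ^ 2 ≤ αmax / (1 - ν) * P.gap m xs (σ k) (x k) := by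
  rw [div_mul_eq_mul_div, le_div_iff₀' (sub_pos.2 h.ν_mem.2)]
  have hdecrease := sub_nonneg.2 (h.val_succ_le k)
  calc (1 - ν) * ‖x k - x (k + 1)‖ ^ 2
      ≤ α (k + 1) * (P.val (σ (k + 1)) (x k) - P.val (σ (k + 1)) (x (k + 1))) :=
        (h.isAdaBiM.x_succ k).one_sub_mul_sq_le h.basicAssumption (h.slow.pos _)
          (h.stepsize_pos _) (h.mem_dom k) (h.mul_lipEst_le (h.stepsize_pos _))
    _ ≤ αmax * P.gap m xs (σ k) (x k) := by
        refine mul_le_mul (h.stepsize_succ_le_max k) ?_ hdecrease h.αmax_pos.le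
        exact (h.val_sub_succ_le_gap_sub hm k).trans (sub_le_self _ (h.gap_nonneg hm hxs _))

theorem mul_scaledRatio_le (h : P.IsAdaBiMRun η ν αmax σ xinit αinit α₀ x α) (k : ℕ) :
    σ (k + 2) * α (k + 2) / σ (k + 1) * scaledRatio σ α αinit (k + 2) ≤
      gapWeight αmax αinit α₀ := by
  have hstep : σ (k + 2) * α (k + 2) / σ (k + 1) ≤ αmax := by
    rw [mul_div_right_comm]
    exact (mul_le_of_le_one_left (h.stepsize_pos _).le
      (div_le_one_of_le₀ (h.slow.mem_Icc (k + 1)).2 (h.slow.pos _).le)).trans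
      (h.stepsize_succ_le_max (k + 1))
  exact mul_le_mul hstep (h.scaledRatio_le _) (h.scaledRatio_nonneg _) h.αmax_pos.le

theorem adaBiMEnergy_succ_le (h : P.IsAdaBiMRun η ν αmax σ xinit αinit α₀ x α)
    (hm : ∀ x ∈ P.dom, m ≤ P.val₁ x) (k : ℕ) {w : EuclideanSpace ℝ (Fin n)} (hw : w ∈ P.X₁) :
    P.adaBiMEnergy (gapWeight αmax αinit α₀) m xs σ α x (k + 1) w ≤
      P.adaBiMEnergy (gapWeight αmax αinit α₀) m xs σ α x k w
        - σ (k + 2) * α (k + 2) / σ (k + 1)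
          * (P.val (σ (k + 1)) (x (k + 1)) - P.val (σ (k + 1)) w) := by
  have henergy := (h.isAdaBiM.x_succ k).energy_le (h.isAdaBiM.x_succ (k + 1)) h.basicAssumption
    (h.slow.pos _) (h.slow.pos _) (h.slow.mem_Icc (k + 1)).2 (h.stepsize_pos _)
    (h.stepsize_pos _) (h.radicand_pos (k + 1)).le (h.stepsize_succ_le_trialStepsize (k + 1))
    (h.mem_dom k) hw
  have habsorb := mul_le_mul (h.mul_scaledRatio_le k) (h.val_sub_succ_le_gap_sub (xs := xs) hm k)
    (sub_nonneg.2 (h.val_succ_le k)) h.gapWeight_nonneg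
  simp only [scaledRatio, prev] at habsorb
  simp only [adaBiMEnergy, prev, add_assoc, Nat.reduceAdd] at henergy ⊢
  linarith

theorem le_adaBiMEnergy (h : P.IsAdaBiMRun η ν αmax σ xinit αinit α₀ x α)
    (hm : ∀ x ∈ P.dom, m ≤ P.val₁ x) (hxs : xs ∈ P.X₁) (k : ℕ) (w : EuclideanSpace ℝ (Fin n)) :
    ‖x (k + 1) - w‖ ^ 2 / 2 ≤
      P.adaBiMEnergy (gapWeight αmax αinit α₀) m xs σ α x k w := by
  have hdisplacement := displacementEnergy_nonneg (h.radicand_pos (k + 1)).le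
  have hgap := mul_nonneg h.gapWeight_nonneg (h.gap_nonneg hm hxs k)
  exact (le_add_of_nonneg_right hdisplacement).trans (le_add_of_nonneg_right hgap)

theorem adaBiMEnergy_le (h : P.IsAdaBiMRun η ν αmax σ xinit αinit α₀ x α)
    (hm : ∀ x ∈ P.dom, m ≤ P.val₁ x) (hxs : xs ∈ P.X₁) (k : ℕ) (w : EuclideanSpace ℝ (Fin n)) :
    P.adaBiMEnergy (gapWeight αmax αinit α₀) m xs σ α x k w ≤
      (‖x k - w‖ + energySlack (αmax / (1 - ν)) (gapWeight αmax αinit α₀)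
        (P.gap m xs (σ k) (x k))) ^ 2 / 2
      + energySlack (αmax / (1 - ν)) (gapWeight αmax αinit α₀) (P.gap m xs (σ k) (x k)) := by
  set B := αmax / (1 - ν)
  set C := gapWeight αmax αinit α₀
  set g := P.gap m xs (σ k) (x k) with hg
  have hB : 0 ≤ B := div_nonneg h.αmax_pos.le (sub_nonneg.2 h.ν_mem.2.le)
  have hC : 0 ≤ C := h.gapWeight_nonneg
  have hg₀ : 0 ≤ g := h.gap_nonneg hm hxs k
  have hsq : ‖x k - x (k + 1)‖ ^ 2 ≤ B * g := h.sq_norm_sub_succ_le hm hxs k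
  have hsqrt : √(B * g) ≤ energySlack B C g := le_add_of_nonneg_right (by positivity)
  have hrest : B * g / 4 + C * g ≤ energySlack B C g := le_add_of_nonneg_left (Real.sqrt_nonneg _)
  have hdist : ‖x (k + 1) - w‖ ≤ ‖x k - w‖ + energySlack B C g := by
    rw [norm_sub_rev (x k)] at hsq
    linarith [norm_sub_le_norm_sub_add_norm_sub (x (k + 1)) (x k) w, Real.le_sqrt_of_sq_le hsq]
  have hdisplacement := displacementEnergy_le h.basicAssumption (h.slow.pos k)
    (h.slow.mem_Icc k).2 (h.stepsize_pos (k + 1)).le (xp := x k) (x := x (k + 1))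
  have hdist_sq : ‖x (k + 1) - w‖ ^ 2 ≤ (‖x k - w‖ + energySlack B C g) ^ 2 := by gcongr
  rw [adaBiMEnergy, ← hg]
  linarith

theorem isFejerEnergy (h : P.IsAdaBiMRun η ν αmax σ xinit αinit α₀ x α)
    (hm : ∀ x ∈ P.dom, m ≤ P.val₁ x) (hxs : xs ∈ P.X₁) :
    P.IsFejerEnergy (fun k => σ (k + 1)) (fun k => σ (k + 2) * α (k + 2) / σ (k + 1))
      (fun k => energySlack (αmax / (1 - ν)) (gapWeight αmax αinit α₀)
        (P.gap m xs (σ (k + 1)) (x (k + 1))))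
      (fun k => x (k + 1)) (fun k => x (k + 1))
      (P.adaBiMEnergy (gapWeight αmax αinit α₀) m xs σ α x) where
  σ_nonneg _ := (h.slow.pos _).le
  τ_nonneg _ :=
    div_nonneg (mul_nonneg (h.slow.pos _).le (h.stepsize_pos _).le) (h.slow.pos _).le
  ω_nonneg _ := energySlack_nonneg (div_nonneg h.αmax_pos.le (sub_nonneg.2 h.ν_mem.2.le))
    h.gapWeight_nonneg (h.gap_nonneg hm hxs _)
  mem_dom _ := h.mem_dom _
  decrease k _ hw := h.adaBiMEnergy_succ_le hm k hw
  lower k w _ := h.le_adaBiMEnergy hm hxs k w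
  upper k w _ := h.adaBiMEnergy_le hm hxs (k + 1) w

theorem exists_norm_le (h : P.IsAdaBiMRun η ν αmax σ xinit αinit α₀ x α) :
    ∃ K : ℝ, ∀ k, ‖x k‖ ≤ K := by
  obtain ⟨xs, hxs⟩ := h.basicAssumption.X₁_nonempty
  obtain ⟨m, hm⟩ := exists_le_val₁ h.basicAssumption
  have hgap : ∀ k, P.gap m xs (σ k) (x k) ≤ P.gap m xs (σ 0) (x 0) := fun k =>
    h.antitone_gap hm (Nat.zero_le k)
  have hB : 0 ≤ αmax / (1 - ν) := div_nonneg h.αmax_pos.le (sub_nonneg.2 h.ν_mem.2.le)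
  obtain ⟨R, hR⟩ := (h.isFejerEnergy hm hxs).exists_norm_le h.basicAssumption
    (fun k => energySlack_mono hB h.gapWeight_nonneg (hgap (k + 1)))
    (fun k => sub_le_iff_le_add.1
      ((val₂_sub_le_gap hm (h.mem_dom (k + 1)) (h.slow.pos (k + 1)).le).trans (hgap (k + 1))))
  refine ⟨max ‖x 0‖ R, ?_⟩
  rintro (_ | k)
  exacts [le_max_left _ _, (hR k).trans (le_max_right _ _)]

theorem convergesToSolutions (h : P.IsAdaBiMRun η ν αmax σ xinit αinit α₀ x α)
    (hzero : Tendsto σ atTop (𝓝 0))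
    (hsum : Tendsto (fun m => ∑ k ∈ Finset.range m, σ k) atTop atTop) :
    P.ConvergesToSolutions x := by
  obtain ⟨xs, hxs⟩ := h.basicAssumption.X₁_nonempty
  obtain ⟨m, hm⟩ := exists_le_val₁ h.basicAssumption
  have henergy := h.isFejerEnergy hm hxs
  obtain ⟨K, hK⟩ := h.exists_norm_le
  obtain ⟨c, hc, hcα⟩ := h.exists_le_stepsize hK
  have hτ : ∀ k, 3 / 4 * c ≤ σ (k + 2) * α (k + 2) / σ (k + 1) := fun k => by
    rw [mul_div_right_comm]
    exact mul_le_mul ((le_div_iff₀ (h.slow.pos _)).2 (h.slow.mem_Icc (k + 1)).1) (hcα _) hc.le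
      (div_nonneg (h.slow.pos _).le (h.slow.pos _).le)
  have hc' : 0 < 3 / 4 * c := by positivity
  have hanti : Antitone fun k => P.gap m xs (σ (k + 1)) (x (k + 1)) := fun i j hij =>
    h.antitone_gap hm (Nat.succ_le_succ hij)
  have hgap := henergy.tendsto_gap h.basicAssumption hm hxs hanti hc' hτ
    (hzero.comp (tendsto_add_atTop_nat 1))
  have hval₂ := tendsto_val₂_of_tendsto_gap h.basicAssumption hm hxs henergy.mem_dom
    henergy.σ_nonneg hgap
  have hdist := henergy.tendsto_infDist h.basicAssumption hxs (tendsto_energySlack hgap) hval₂ hc'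
    hτ (tendsto_sum_range_succ_atTop hsum)
  exact .of_tendsto_infDist h.basicAssumption
    ((tendsto_add_atTop_iff_nat (f := fun k => Metric.infDist (x k) P.X₁) 1).1 hdist)

end Convergence

end IsAdaBiMRun

end BilevelProblem

theorem mainTheorem2_general {n : ℕ} (P : BilevelProblem n) (hP : P.BasicAssumption)
    (σ : ℕ → ℝ) (hσ : IsSlowlyDecreasing σ) (hzero : Tendsto σ atTop (𝓝 0))
    (hsum : Tendsto (fun m => ∑ k ∈ Finset.range m, σ k) atTop atTop) (ν : ℝ)
    (hν : ν ∈ Set.Ioo (0 : ℝ) 1) :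
    (∀ (η αmax αinit α₀ : ℝ) (xinit : EuclideanSpace ℝ (Fin n)),
      η ∈ Set.Ioo (0 : ℝ) 1 → 0 < αmax → 0 < αinit → 0 < α₀ →
        (∃ x α, P.IsAdaBiM η ν αmax σ xinit αinit α₀ x α) ∧
        ∀ x α, P.IsAdaBiM η ν αmax σ xinit αinit α₀ x α → P.ConvergesToSolutions x) ∧
    (∀ (L₁ L₂ : ℝ≥0) (x₀ : EuclideanSpace ℝ (Fin n)),
      LipschitzWith L₁ (∇ P.f₁) → LipschitzWith L₂ (∇ P.f₂) → 0 < L₁ + L₂ →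
        (∃ x, P.IsStaBiM ν L₁ L₂ σ x₀ x) ∧
        ∀ x, P.IsStaBiM ν L₁ L₂ σ x₀ x → P.ConvergesToSolutions x) := by
  refine ⟨fun η αmax αinit α₀ xinit hη hmax hinit hα₀ => ⟨?_, fun x α h => ?_⟩,
    fun L₁ L₂ x₀ h₁ h₂ hL => ⟨?_, fun x h => ?_⟩⟩
  · exact BilevelProblem.exists_isAdaBiM hP hσ hν hη hmax hinit hα₀ xinit
  · have hrun : P.IsAdaBiMRun η ν αmax σ xinit αinit α₀ x α :=
      ⟨h, hP, hσ, hν, hη, hmax, hinit, hα₀⟩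
    exact hrun.convergesToSolutions hzero hsum
  · exact BilevelProblem.exists_isStaBiM hP hσ.pos hν.1 hL x₀
  · exact h.convergesToSolutions hP hσ.pos hσ.antitone hzero hsum (Set.Ioo_subset_Ioc_self hν)
      h₁ h₂ hL

theorem mainTheorem2 {n : ℕ} (P : BilevelProblem n) (hP : P.BasicAssumption)
    (σ : ℕ → ℝ) (hσ : IsPenaltySeq σ) (ν : ℝ) (hν : ν ∈ Set.Ioo (0 : ℝ) 1) :
    (∀ (η αmax αinit α₀ : ℝ) (xinit : EuclideanSpace ℝ (Fin n)),
      η ∈ Set.Ioo (0 : ℝ) 1 → 0 < αmax → 0 < αinit → αinit ≤ α₀ →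
        (∃ x α, P.IsAdaBiM η ν αmax σ xinit αinit α₀ x α) ∧
        ∀ x α, P.IsAdaBiM η ν αmax σ xinit αinit α₀ x α → P.ConvergesToSolutions x) ∧
    (∀ (L₁ L₂ : ℝ≥0) (x₀ : EuclideanSpace ℝ (Fin n)),
      LipschitzWith L₁ (∇ P.f₁) → LipschitzWith L₂ (∇ P.f₂) → 0 < L₁ + L₂ →
        (∃ x, P.IsStaBiM ν L₁ L₂ σ x₀ x) ∧
        ∀ x, P.IsStaBiM ν L₁ L₂ σ x₀ x → P.ConvergesToSolutions x) := by
  have h := mainTheorem2_general P hP σ ⟨hσ.pos, hσ.mem⟩ hσ.tendsto_zero hσ.sum_eq_top ν hν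
  exact ⟨fun η αmax αinit α₀ xinit hη hmax hinit h₀ =>
    h.1 η αmax αinit α₀ xinit hη hmax hinit (hinit.trans_le h₀), h.2⟩
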